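/- Let $Q\ge 1$ and $P\ne 0$ be integers, let $\gamma,\delta$ be integers with $Q\delta-P\gamma=1$, and put $b=P/Q$. Let $A=e^{\ell}$ with $\ell\in\mathbb{C}$; all powers of $A$ are understood as $A^r=e^{r\ell}$, and $\log A^2=2\ell$. On the charge-zero part of the semi-infinite wedge space, with $\psi_k$ ($k\in\mathbb{Z}+\tfrac12$) the exterior multiplication by the $k$-th basis vector, $\psi_k^*$ its adjoint, and $E_{ij}={:}\psi_i\psi_j^*{:}$ (equal to $\psi_i\psi_j^*$ if $j>0$ and to $-\psi_j^*\psi_i$ if $j<0$), let $\alpha_k=\sum_{l\in\mathbb{Z}+1/2}E_{l-k,l}$ for $k\neq0$ and $\mathcal{F}_2=\sum_{k\in\mathbb{Z}+1/2}\frac{k^2}{2}E_{k,k}$. The extended Ooguri–Vafa partition function of the torus knot $T[Q,P]$ is the vacuum expectation value $$Z^{ext}=\Big\langle \exp\Big(\sum_{i\ge1}\frac{\alpha_i}{i}\,\frac{A^i-A^{-i}}{e^{i\hbar/2}-e^{-i\hbar/2}}\Big)\exp\big(b\hbar\,\mathcal{F}_2\big)\exp\Big(\sum_{j\ge1}\frac{\alpha_{-j}}{j}\,QA^{bj}\,\bar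 p_{j/Q}\Big)\Big\rangle ,$$ a formal power series in the variables $\bar p_{j/Q}$, $j\ge1$, over $\mathbb{C}((\hbar))$. Put $$C^{(0)}_m=[\hbar^{-1}]\,\frac{\partial}{\partial \bar p_{m/Q}}\log Z^{ext}\Big|_{\bar p=0},\qquad \xi^1_m=(-1)^mA^{(b-1)m}\,\mathcal{P}^{(m(b-1),1)}_{m-1}(1-2A^2),\qquad m\ge1,$$ where $\mathcal{P}_n^{(\alpha,\beta)}$ are the Jacobi polynomials. Consider the functions $$x(U)=Q\log U+P\log(1-A^{b+1}U)-P\log(1-A^{b-1}U),$$ $$y(U)=\tfrac{\gamma}{Q}x(U)+\tfrac1Q\log(1-A^{b+1}U)-\tfrac1Q\log(1-A^{b-1}U),$$ with any continuous determinations of the logarithms on an open set $\Omega\subseteq\mathbb{C}$ such that $\log(1-A^{b+1}U)-\log(1-A^{b-1}U)\to\log A^2$ as $U\to\infty$ in $\Omega$, and put $\lambda=x/Q$, $\Lambda=e^{\lambda}$. Let $$F_{0,1}(U)=\sum_{m\ge1}C^{(0)}_m\,\Lambda(U)^{-m}.$$ Theorem. (i) For all $m\ge1$, $\;C^{(0)}_m=\dfrac{Q(1-A^2)}{m^2}\,\xi^1_m$.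 (ii) For all $U\in\Omega$ with $|U|$ sufficiently large, the series $F_{0,1}(U)$ converges, $F_{0,1}$ and $\lambda$ are complex differentiable at $U$, $\lambda'(U)\ne0$, and $$-\frac{1}{Q^2}\,\frac{d}{d\lambda}F_{0,1}(U)+\frac1Q\log A^2=y(U)-\frac{\gamma}{Q}\,x(U).$$ If $\Omega$ is connected and unbounded, then this identity also holds for every holomorphic function on $\Omega$ that agrees with $F_{0,1}$ for large $|U|$, in place of $F_{0,1}$, at every $U\in\Omega$ with $\lambda'(U)\neq0$. -/

import Mathlib

open Filter Topology Bornology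

noncomputable section

namespace TorusKnot

/-! ### The semi-infinite wedge space

A half-integer `n + 1/2` is encoded by the integer `n`; it is positive iff `0 ≤ n`. -/

/-- A decreasing sequence of half-integers `i₁ > i₂ > ⋯` with `i_k + k - 1/2` eventually constant is
determined by the set of its terms; the sets that arise are those with finitely many positive
elements which miss only finitely many negative half-integers. -/
def Maya : Type :=
  {S : Set ℤ // (S ∩ Set.Ici 0).Finite ∧ (Set.Iio 0 \ S).Finite}

/-- The vacuum `-1/2 ∧ -3/2 ∧ ⋯`. -/
def Maya.vac : Maya :=
  ⟨Set.Iio 0, by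
    have h : Set.Iio (0 : ℤ) ∩ Set.Ici 0 = ∅ := by
      ext x; simp
    rw [h]; exact Set.finite_empty, by simp⟩

/-- Adjoin the factor `n + 1/2`. -/
def Maya.insert (n : ℤ) (S : Maya) : Maya :=
  ⟨Insert.insert n S.1, by
    refine Set.Finite.subset (S.2.1.union (Set.finite_singleton n)) ?_
    rintro x ⟨rfl | hx, h0⟩
    · exact Or.inr rfl
    · exact Or.inl ⟨hx, h0⟩,
   S.2.2.subset (Set.sdiff_subset_sdiff_right (Set.subset_insert n S.1))⟩

/-- Remove the factor `n + 1/2`. -/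
def Maya.erase (n : ℤ) (S : Maya) : Maya :=
  ⟨S.1 \ {n}, S.2.1.subset (Set.inter_subset_inter_left _ Set.sdiff_subset), by
    refine Set.Finite.subset (S.2.2.union (Set.finite_singleton n)) ?_
    rintro x ⟨hx, h0⟩
    by_cases h : x = n
    · exact Or.inr h
    · exact Or.inl ⟨hx, fun hS => h0 ⟨hS, h⟩⟩⟩

/-- The coefficient field `ℂ((ħ))`. -/
def Coef : Type := LaurentSeries ℂ

instance : Field Coef := inferInstanceAs (Field (LaurentSeries ℂ))

/-- The embedding of the constants. -/
def Coef.const : ℂ →+* Coef := (HahnSeries.C : ℂ →+* LaurentSeries ℂ)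

instance : CharZero Coef := charZero_of_injective_ringHom Coef.const.injective

/-- The coefficient of `ħ ^ k`. -/
def Coef.coeffHbar (k : ℤ) (c : Coef) : ℂ := HahnSeries.coeff (show LaurentSeries ℂ from c) k

/-- The semi-infinite wedge space (all charges), with its basis of wedge products. -/
abbrev Wedge : Type := Maya →₀ Coef

/-- The basis vector of the wedge space attached to a wedge product. -/
def basisVec (S : Maya) : Wedge := Finsupp.single S 1

/-- The operator with prescribed values on the basis vectors. -/
def opOfBasis (f : Maya → Wedge) : Module.End Coef Wedge :=
  Finsupp.linearCombination Coef f

/-- The sign of moving the factor `n + 1/2` from the front to its place in decreasing order. -/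
def wedgeSign (n : ℤ) (S : Maya) : Coef := (-1) ^ (S.1 ∩ Set.Ioi n).ncard

open Classical in
/-- `ψ_k`, `k = n + 1/2`: exterior multiplication by the factor `k`. -/
def psi (n : ℤ) : Module.End Coef Wedge :=
  opOfBasis fun S => if n ∈ S.1 then 0 else wedgeSign n S • basisVec (S.insert n)

open Classical in
/-- `ψ_k^*`, `k = n + 1/2`: the adjoint of `ψ_k`, see `psi_adjoint`. -/
def psiStar (n : ℤ) : Module.End Coef Wedge :=
  opOfBasis fun S => if n ∈ S.1 then wedgeSign n S • basisVec (S.erase n) else 0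

/-- The normally ordered product `E_{ij} = :ψ_i ψ_j^*:` (half-integer indices encoded as above). -/
def normalE (i j : ℤ) : Module.End Coef Wedge :=
  if 0 ≤ j then psi i * psiStar j else -(psiStar j * psi i)

theorem opOfBasis_basisVec (f : Maya → Wedge) (S : Maya) : opOfBasis f (basisVec S) = f S := by
  simp [opOfBasis, basisVec]

theorem wedgeSign_mul_self (n : ℤ) (S : Maya) : wedgeSign n S * wedgeSign n S = 1 := by
  rw [wedgeSign, ← pow_add, Even.neg_one_pow ⟨_, rfl⟩]

theorem wedgeSign_insert (n : ℤ) (S : Maya) : wedgeSign n (S.insert n) = wedgeSign n S := by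
  have h : (S.insert n).1 ∩ Set.Ioi n = S.1 ∩ Set.Ioi n := by
    ext x; simp only [Maya.insert, Set.mem_inter_iff, Set.mem_insert_iff, Set.mem_Ioi]
    constructor
    · rintro ⟨rfl | hx, h⟩
      · exact absurd h (lt_irrefl _)
      · exact ⟨hx, h⟩
    · rintro ⟨hx, h⟩; exact ⟨Or.inr hx, h⟩
  rw [wedgeSign, wedgeSign, h]

theorem wedgeSign_erase (n : ℤ) (S : Maya) : wedgeSign n (S.erase n) = wedgeSign n S := by
  have h : (S.erase n).1 ∩ Set.Ioi n = S.1 ∩ Set.Ioi n := by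
    ext x; simp only [Maya.erase, Set.mem_inter_iff, Set.mem_sdiff, Set.mem_singleton_iff,
      Set.mem_Ioi]
    constructor
    · rintro ⟨⟨hx, -⟩, h⟩; exact ⟨hx, h⟩
    · rintro ⟨hx, h⟩; exact ⟨⟨hx, h.ne'⟩, h⟩
  rw [wedgeSign, wedgeSign, h]

theorem Maya.insert_erase {n : ℤ} {S : Maya} (h : n ∈ S.1) : (S.erase n).insert n = S := by
  apply Subtype.ext
  simp [Maya.insert, Maya.erase, Set.insert_eq_of_mem h]

theorem Maya.erase_insert {n : ℤ} {S : Maya} (h : n ∉ S.1) : (S.insert n).erase n = S := by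
  apply Subtype.ext
  simp [Maya.insert, Maya.erase, h]

/-- `ψ_k^*` is the adjoint of `ψ_k` with respect to the form with orthonormal basis the wedge
products. -/
theorem psi_adjoint (n : ℤ) (S T : Maya) :
    psi n (basisVec S) T = psiStar n (basisVec T) S := by
  classical
  rw [psi, psiStar, opOfBasis_basisVec, opOfBasis_basisVec]
  by_cases hS : n ∈ S.1 <;> by_cases hT : n ∈ T.1
  · have : T.erase n ≠ S := by
      rintro rfl; simp [Maya.erase] at hS
    simp [hS, hT, basisVec, this]
  · simp [hS, hT]
  · simp only [hS, hT, if_true, if_false, Finsupp.smul_apply, basisVec, smul_eq_mul]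
    by_cases h : S.insert n = T
    · subst h
      rw [Maya.erase_insert hS, wedgeSign_insert]; simp
    · have h2 : T.erase n ≠ S := by
        rintro rfl; exact h (Maya.insert_erase hT)
      simp [h, h2]
  · have : S.insert n ≠ T := by
      rintro rfl; simp [Maya.insert] at hT
    simp [hS, hT, basisVec, this]

open Classical in
/-- The action of `E_{kk}`, `k = n + 1/2`, on a basis vector. -/
theorem normalE_diag (n : ℤ) (S : Maya) : normalE n n (basisVec S) =
    Coef.const (if 0 ≤ n then (if n ∈ S.1 then 1 else 0) else (if n ∈ S.1 then 0 else -1)) •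
      basisVec S := by
  by_cases h0 : 0 ≤ n <;> by_cases hS : n ∈ S.1
  · have h1 : n ∉ (S.erase n).1 := by simp [Maya.erase]
    simp [normalE, h0, hS, psi, psiStar, opOfBasis_basisVec, h1, Maya.insert_erase hS, smul_smul,
      wedgeSign_erase, wedgeSign_mul_self]
  · simp [normalE, h0, hS, psiStar, opOfBasis_basisVec]
  · simp [normalE, h0, hS, psi, opOfBasis_basisVec]
  · have h1 : n ∈ (S.insert n).1 := by simp [Maya.insert]
    simp [normalE, h0, hS, psi, psiStar, opOfBasis_basisVec, h1, Maya.erase_insert hS, smul_smul,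
      wedgeSign_insert, wedgeSign_mul_self]

/-- `α_k = ∑_l E_{l-k, l}`, for `k ≠ 0`; on each basis vector the sum is finite. -/
def alpha (k : ℤ) : Module.End Coef Wedge :=
  opOfBasis fun S => ∑ᶠ l : ℤ, normalE (l - k) l (basisVec S)

/-- The operator `F₂ = ∑_k (k²/2) E_{kk}`, `k = n + 1/2`; on each basis vector the sum is finite. -/
def opF2 : Module.End Coef Wedge :=
  opOfBasis fun S => ∑ᶠ n : ℤ,
    Coef.const (((n : ℂ) + 1 / 2) ^ 2 / 2) • normalE n n (basisVec S)

/-- The eigenvalue of `F₂` on a basis vector, see `opF2_basisVec`. -/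
def eigF2 (S : Maya) : ℂ := (opF2 (basisVec S) S).coeffHbar 0

open Classical in
/-- `F₂` is diagonal, and `eigF2` is its eigenvalue. -/
theorem opF2_basisVec (S : Maya) :
    eigF2 S = ∑ᶠ n : ℤ, ((n : ℂ) + 1 / 2) ^ 2 / 2 *
      (if 0 ≤ n then (if n ∈ S.1 then 1 else 0) else (if n ∈ S.1 then 0 else -1)) ∧
    opF2 (basisVec S) = Coef.const (eigF2 S) • basisVec S := by
  have hfin : (Function.support fun n : ℤ => ((n : ℂ) + 1 / 2) ^ 2 / 2 *
      (if 0 ≤ n then (if n ∈ S.1 then 1 else 0) else (if n ∈ S.1 then 0 else -1))).Finite := by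
    refine (S.2.1.union S.2.2).subset fun n hn => ?_
    by_cases h0 : 0 ≤ n <;> by_cases hS : n ∈ S.1
    · exact Or.inl ⟨hS, h0⟩
    · simp [h0, hS] at hn
    · simp [h0, hS] at hn
    · exact Or.inr ⟨not_le.mp h0, hS⟩
  have key : opF2 (basisVec S) = Coef.const (∑ᶠ n : ℤ, ((n : ℂ) + 1 / 2) ^ 2 / 2 *
      (if 0 ≤ n then (if n ∈ S.1 then 1 else 0) else (if n ∈ S.1 then 0 else -1))) •
        basisVec S := by
    have hm := AddMonoidHom.map_finsum (Coef.const : ℂ →+ Coef) hfin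
    simp only [AddMonoidHom.coe_coe] at hm
    rw [opF2, opOfBasis_basisVec, hm, finsum_smul]
    refine finsum_congr fun n => ?_
    rw [normalE_diag, smul_smul, ← map_mul]
  have h1 : eigF2 S = ∑ᶠ n : ℤ, ((n : ℂ) + 1 / 2) ^ 2 / 2 *
      (if 0 ≤ n then (if n ∈ S.1 then 1 else 0) else (if n ∈ S.1 then 0 else -1)) := by
    rw [eigF2, key]
    simp only [basisVec, Finsupp.smul_apply, Finsupp.single_eq_same, smul_eq_mul, mul_one]
    exact HahnSeries.coeff_single_same _ _
  exact ⟨h1, by rw [h1]; exact key⟩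

/-! ### The extended partition function of the torus knot `T[Q,P]`

The parameter `A` is `exp ℓ` for a complex number `ℓ` (a logarithm of `A`), which also fixes the
meaning of its powers. -/

/-- `A ^ r`. -/
def powA (ℓ r : ℂ) : ℂ := Complex.exp (r * ℓ)

/-- The number `b = P / Q`. -/
def slope (P : ℤ) (Q : ℕ) : ℂ := (P : ℂ) / (Q : ℂ)

/-- `exp (c ħ)` as a formal series in `ħ`. -/
def expHbar (c : ℂ) : Coef :=
  (HahnSeries.ofPowerSeries ℤ ℂ (PowerSeries.rescale c (PowerSeries.exp ℂ)) : LaurentSeries ℂ)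

/-- The topological locus
`p*_i = (A^i - A^{-i}) / (exp (ħ i / 2) - exp (- ħ i / 2))`. -/
def pStar (ℓ : ℂ) (i : ℕ+) : Coef :=
  Coef.const (powA ℓ (i : ℕ) - powA ℓ (-((i : ℕ) : ℂ))) /
    (expHbar (((i : ℕ) : ℂ) / 2) - expHbar (-(((i : ℕ) : ℂ) / 2)))

/-- Formal power series in the variables `p̄_{i/Q}`, `i ≥ 1`, with coefficients in the wedge space.
The variable `p̄_{i/Q}` has index `i`. -/
abbrev State : Type := (ℕ+ →₀ ℕ) → Wedge

open Classical in
/-- The vacuum vector, as a constant series. -/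
def vacState : State := fun μ => if μ = 0 then basisVec Maya.vac else 0

/-- The operator `∑_{i ≥ 1} α_i p*_i / i` on the wedge space; on each basis vector the sum is
finite. -/
def annihilation (ℓ : ℂ) : Module.End Coef Wedge :=
  opOfBasis fun S => ∑ᶠ i : ℕ+, (pStar ℓ i / ((i : ℕ) : Coef)) • alpha (i : ℕ) (basisVec S)

/-- The operator `exp (u F₂)`, where `u = b ħ`. -/
def expF2 (P : ℤ) (Q : ℕ) : Module.End Coef Wedge :=
  opOfBasis fun S => expHbar (slope P Q * eigF2 S) • basisVec S

/-- The operator `∑_{j ≥ 1} α_{-j} p̃_j / j`, where `p̃_j = Q A^{bj} p̄_{j/Q}`, on formal series: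
multiplication by `p̄_{j/Q}` shifts exponents. -/
def creation (P : ℤ) (Q : ℕ) (ℓ : ℂ) (Φ : State) : State := fun μ =>
  ∑ j ∈ μ.support,
    Coef.const ((Q : ℂ) * powA ℓ (slope P Q * (j : ℕ)) / ((j : ℕ) : ℂ)) •
      alpha (-((j : ℕ) : ℤ)) (Φ (μ - Finsupp.single j 1))

/-- The exponential `∑_n T^n / n!`. It is applied to operators for which, in each degree in the
variables, only finitely many terms of the sum do not vanish. -/
def expOp (T : State → State) (Φ : State) : State := fun μ =>
  ∑ᶠ n : ℕ, ((n.factorial : Coef)⁻¹) • (T^[n] Φ) μ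

/-- The vacuum expectation value
`Z^ext = ⟨exp (∑ α_i p*_i / i) exp (u F₂) exp (∑ α_{-j} p̃_j / j)⟩`,
a formal power series in the variables `p̄_{i/Q}` over `ℂ((ħ))`. -/
def Zext (P : ℤ) (Q : ℕ) (ℓ : ℂ) : MvPowerSeries ℕ+ Coef := fun μ =>
  expOp (fun Φ ν => annihilation ℓ (Φ ν))
    (fun ν => expF2 P Q (expOp (creation P Q ℓ) vacState ν)) μ Maya.vac

/-- `log Z^ext`; the constant term of `Z^ext` is `1`. -/
def logZext (P : ℤ) (Q : ℕ) (ℓ : ℂ) : MvPowerSeries ℕ+ Coef :=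
  (PowerSeries.log Coef).subst (Zext P Q ℓ - 1)

/-- The connected correlator
`C^{(g)}_{μ₁ … μ_n} = [ħ^{2g-2+n}] ∂/∂p̄_{μ₁/Q} ⋯ ∂/∂p̄_{μ_n/Q} log Z^ext |_{p̄ = 0}`. -/
def correlator (P : ℤ) (Q : ℕ) (ℓ : ℂ) (g : ℕ) (μ : List ℕ+) : ℂ :=
  Coef.coeffHbar (2 * (g : ℤ) - 2 + (μ.length : ℤ))
    (MvPowerSeries.constantCoeff
      (μ.foldr (fun i f => MvPowerSeries.pderiv Coef i f) (logZext P Q ℓ)))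

/-! ### Jacobi polynomials -/

/-- The Jacobi polynomial `𝒫_n^{(α,β)}(z)`, that is
`Γ(α+n+1) / (Γ(α+1) n!) * ₂F₁(-n, 1+α+β+n; α+1; (1-z)/2)`, written as a polynomial in `α`: for the
`s`-th term `Γ(α+n+1) / (Γ(α+1) (α+1)_s) = (α+s+1)_{n-s}` and `(-n)_s / s! = (-1)^s n.choose s`. -/
def jacobi (n : ℕ) (α β z : ℂ) : ℂ :=
  (n.factorial : ℂ)⁻¹ * ∑ s ∈ Finset.range (n + 1),
    (-1) ^ s * (n.choose s : ℂ) * (ascPochhammer ℂ s).eval (1 + α + β + n) *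
      (ascPochhammer ℂ (n - s)).eval (α + s + 1) * ((1 - z) / 2) ^ s

/-- `ξ¹_m = (-1)^m A^{(b-1)m} 𝒫_{m-1}^{(m(b-1), 1)}(1 - 2A²)`. -/
def xiOne (P : ℤ) (Q : ℕ) (ℓ : ℂ) (m : ℕ+) : ℂ :=
  (-1) ^ (m : ℕ) * powA ℓ ((slope P Q - 1) * (m : ℕ)) *
    jacobi ((m : ℕ) - 1) ((m : ℕ) * (slope P Q - 1)) 1 (1 - 2 * powA ℓ 2)

/-! ### The spectral curve near `Λ = ∞` -/

/-- `L` is a determination on `Ω` of the logarithm of `f`. -/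
def IsLogOn (Ω : Set ℂ) (f L : ℂ → ℂ) : Prop :=
  ContinuousOn L Ω ∧ ∀ U ∈ Ω, Complex.exp (L U) = f U

/-- A choice, on an open set `Ω`, of determinations `L₀`, `L₊`, `L₋` of `log U`,
`log (1 - A^{b+1} U)`, `log (1 - A^{b-1} U)`, such that `L₊ - L₋` tends to `log A² = 2ℓ` as `U → ∞`
in `Ω` (the quotient of the two arguments tends to `A²`). -/
structure IsBranch (P : ℤ) (Q : ℕ) (ℓ : ℂ) (Ω : Set ℂ) (L₀ Lp Lm : ℂ → ℂ) : Prop where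
  isOpen : IsOpen Ω
  log_U : IsLogOn Ω (fun U => U) L₀
  log_plus : IsLogOn Ω (fun U => 1 - powA ℓ (slope P Q + 1) * U) Lp
  log_minus : IsLogOn Ω (fun U => 1 - powA ℓ (slope P Q - 1) * U) Lm
  tendsto : Tendsto (fun U => Lp U - Lm U) (cobounded ℂ ⊓ 𝓟 Ω) (𝓝 (2 * ℓ))

/-- `x(U) = Q log U + P log (1 - A^{b+1} U) - P log (1 - A^{b-1} U)`. -/
def curveX (P : ℤ) (Q : ℕ) (L₀ Lp Lm : ℂ → ℂ) (U : ℂ) : ℂ :=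
  (Q : ℂ) * L₀ U + (P : ℂ) * Lp U - (P : ℂ) * Lm U

/-- `y(U) = (γ/Q) x(U) + (1/Q) log (1 - A^{b+1} U) - (1/Q) log (1 - A^{b-1} U)`. -/
def curveY (P : ℤ) (Q : ℕ) (γ : ℤ) (L₀ Lp Lm : ℂ → ℂ) (U : ℂ) : ℂ :=
  (γ : ℂ) / (Q : ℂ) * curveX P Q L₀ Lp Lm U + 1 / (Q : ℂ) * Lp U - 1 / (Q : ℂ) * Lm U

/-- `λ = log Λ = x / Q`. -/
def curveLam (P : ℤ) (Q : ℕ) (L₀ Lp Lm : ℂ → ℂ) (U : ℂ) : ℂ :=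
  curveX P Q L₀ Lp Lm U / (Q : ℂ)

/-- The terms of `F_{0,1} = ∑_{m ≥ 1} C^{(0)}_m Λ^{-m}`, with `Λ = exp λ`. -/
def termF01 (P : ℤ) (Q : ℕ) (ℓ : ℂ) (L₀ Lp Lm : ℂ → ℂ) (U : ℂ) (m : ℕ+) : ℂ :=
  correlator P Q ℓ 0 [m] * ((Complex.exp (curveLam P Q L₀ Lp Lm U)) ^ (m : ℕ))⁻¹

/-- The one-point free energy of genus zero, given by its expansion at `Λ = ∞`. -/
def F01 (P : ℤ) (Q : ℕ) (ℓ : ℂ) (L₀ Lp Lm : ℂ → ℂ) (U : ℂ) : ℂ :=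
  ∑' m : ℕ+, termF01 P Q ℓ L₀ Lp Lm U m

/-- The derivative `d/dλ` of a function of `U`. -/
def dLam (P : ℤ) (Q : ℕ) (L₀ Lp Lm : ℂ → ℂ) (F : ℂ → ℂ) (U : ℂ) : ℂ :=
  deriv F U / deriv (curveLam P Q L₀ Lp Lm) U

end TorusKnot

end

open Filter Topology Bornology

noncomputable section

namespace TorusKnot

/-! ### Hook states -/

/-! Write `c = b m`, `u = A^{b+1}`, `v = A^{b-1}` and `L(t) = log ((1 - v t)/(1 - u t))`. Both parts
rest on the formula `C_m = Q/(m c) · [t^m] exp (c L(t))` (`correlator_eq_coeff_exp`).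

Its origin is fermionic. Only the part of `Z^ext` linear in `p̄_{m/Q}` matters, and `α_{-m}` sends
the vacuum to the alternating sum of the hooks with `m` boxes. The eigenvalue of `F₂` on a hook is
affine in the leg length `s`, so `exp (bħ F₂)` produces, up to a scalar, `v_m = ∑ (-y)^s |hook m s⟩`
with `y = e^{-cħ}`. These vectors satisfy `α_k v_m = (1 - y^k) v_{m-k}` (`alpha_hookVec`), so the
annihilation operator acts as convolution with a power series in `t`, and the vacuum expectation is
a coefficient of the exponential of that series, divided by `1 - y`. The zero of `1 - y^k` at `ħ =
0` cancels the pole of `p*_k`; the only remaining pole is the simple one of `(1 - y)⁻¹`, and the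
`ħ^{-1}` coefficient is found by setting `ħ = 0` elsewhere.

For (i), the derivative of `((1 - v t)/(1 - u t))^c` is `c (u - v) (1 - u t)^{-c-1} (1 - v
t)^{c-1}`, and the Cauchy product of the two binomial series is termwise the hypergeometric sum of
the Jacobi polynomial.

For (ii), put `t = A^{-2b}/U`. Then `log (1 - uU) - log (1 - vU) = 2ℓ + L(t)` near infinity, and `X
= 1/Λ = t exp (-b L(t))`. Lagrange inversion gives `[X^m] L(t(X)) = [t^m] exp (c L)/c = m C_m / Q`,
so `X d/dX F_{0,1} = Q L(t)`. As `d/dλ = -X d/dX`, this is the asserted identity. The identity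
theorem carries it to all of a connected `Ω`. -/

theorem psi_basisVec_of_mem {n : ℤ} {S : Maya} (h : n ∈ S.1) : psi n (basisVec S) = 0 := by
  classical
  rw [psi, opOfBasis_basisVec, if_pos h]

theorem psi_basisVec_of_notMem {n : ℤ} {S : Maya} (h : n ∉ S.1) :
    psi n (basisVec S) = wedgeSign n S • basisVec (S.insert n) := by
  classical
  rw [psi, opOfBasis_basisVec, if_neg h]

theorem psiStar_basisVec_of_mem {n : ℤ} {S : Maya} (h : n ∈ S.1) :
    psiStar n (basisVec S) = wedgeSign n S • basisVec (S.erase n) := by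
  classical
  rw [psiStar, opOfBasis_basisVec, if_pos h]

theorem psiStar_basisVec_of_notMem {n : ℤ} {S : Maya} (h : n ∉ S.1) :
    psiStar n (basisVec S) = 0 := by
  classical
  rw [psiStar, opOfBasis_basisVec, if_neg h]

theorem Maya.mem_insert {n x : ℤ} {S : Maya} : x ∈ (S.insert n).1 ↔ x = n ∨ x ∈ S.1 := Iff.rfl

theorem Maya.mem_erase {n x : ℤ} {S : Maya} : x ∈ (S.erase n).1 ↔ x ∈ S.1 ∧ x ≠ n := Iff.rfl

theorem Maya.mem_vac {x : ℤ} : x ∈ Maya.vac.1 ↔ x < 0 := Iff.rfl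

/-- Off the diagonal both orderings move a factor from `j` to `i`, which needs an occupied `j` and a
vacant `i`. -/
theorem normalE_basisVec_eq_zero {i j : ℤ} {S : Maya} (hij : i ≠ j) (h : j ∉ S.1 ∨ i ∈ S.1) :
    normalE i j (basisVec S) = 0 := by
  unfold normalE
  split_ifs
  · rw [Module.End.mul_apply]
    by_cases hj : j ∈ S.1
    · have hi : i ∈ S.1 := h.resolve_left (not_not.mpr hj)
      rw [psiStar_basisVec_of_mem hj, map_smul,
        psi_basisVec_of_mem (Maya.mem_erase.mpr ⟨hi, hij⟩), smul_zero]
    · rw [psiStar_basisVec_of_notMem hj, map_zero]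
  · rw [LinearMap.neg_apply, Module.End.mul_apply]
    by_cases hi : i ∈ S.1
    · rw [psi_basisVec_of_mem hi, map_zero, neg_zero]
    · have hj : j ∉ S.1 := h.resolve_right hi
      have : j ∉ (S.insert i).1 := fun hm => (Maya.mem_insert.mp hm).elim (fun e => hij e.symm) hj
      rw [psi_basisVec_of_notMem hi, map_smul, psiStar_basisVec_of_notMem this, smul_zero,
        neg_zero]

theorem normalE_basisVec_of_nonneg {i j : ℤ} {S : Maya} (h0 : 0 ≤ j) (hj : j ∈ S.1)
    (hi : i ∉ S.1) : normalE i j (basisVec S) =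
      (wedgeSign j S * wedgeSign i (S.erase j)) • basisVec ((S.erase j).insert i) := by
  have : i ∉ (S.erase j).1 := fun hm => hi (Maya.mem_erase.mp hm).1
  rw [normalE, if_pos h0, Module.End.mul_apply, psiStar_basisVec_of_mem hj, map_smul,
    psi_basisVec_of_notMem this, smul_smul]

theorem normalE_basisVec_of_neg {i j : ℤ} {S : Maya} (h0 : j < 0) (hj : j ∈ S.1)
    (hi : i ∉ S.1) : normalE i j (basisVec S) =
      (-(wedgeSign i S * wedgeSign j (S.insert i))) • basisVec ((S.insert i).erase j) := by
  have : j ∈ (S.insert i).1 := Maya.mem_insert.mpr (Or.inr hj)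
  rw [normalE, if_neg (not_le.mpr h0), LinearMap.neg_apply, Module.End.mul_apply,
    psi_basisVec_of_notMem hi, map_smul, psiStar_basisVec_of_mem this, smul_smul, neg_smul]

/-- The vacuum with its factor at `h` moved to `p`. -/
def particleHole (p h : ℤ) : Maya := (Maya.vac.erase h).insert p

theorem wedgeSign_eq_of_coe {n : ℤ} {S : Maya} (F : Finset ℤ)
    (h : ∀ x, (x ∈ S.1 ∧ n < x) ↔ x ∈ F) : wedgeSign n S = (-1) ^ F.card := by
  have : S.1 ∩ Set.Ioi n = (F : Set ℤ) := by
    ext x; simpa using h x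
  rw [wedgeSign, this, Set.ncard_coe_finset]

/-- The hook with `m` boxes and leg length `s`. -/
def hook (m s : ℕ) : Maya := particleHole ((m : ℤ) - 1 - s) (-1 - (s : ℤ))

theorem mem_hook {m s : ℕ} {x : ℤ} :
    x ∈ (hook m s).1 ↔ x = (m : ℤ) - 1 - s ∨ (x < 0 ∧ x ≠ -1 - (s : ℤ)) := Iff.rfl

theorem hook_ne_vac {m s : ℕ} (hs : s < m) : hook m s ≠ Maya.vac := by
  intro h
  have h1 : ((m : ℤ) - 1 - s) ∈ (hook m s).1 := mem_hook.mpr (Or.inl rfl)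
  rw [h, Maya.mem_vac] at h1
  omega

/-- Adding a ribbon of `m` boxes to the empty partition gives a hook: the factor at `-1 - s` jumps
to `m - 1 - s` across `s` other factors, whence the sign. -/
theorem alpha_neg_vac {m : ℕ} (hm : 0 < m) : alpha (-(m : ℤ)) (basisVec Maya.vac) =
    ∑ s ∈ Finset.range m, ((-1 : Coef) ^ s) • basisVec (hook m s) := by
  rw [alpha, opOfBasis_basisVec]
  have hinj : Function.Injective fun s : ℕ => -1 - (s : ℤ) := by
    intro a b h; simp only at h; omega
  rw [finsum_eq_sum_of_support_subset (s := (Finset.range m).map ⟨_, hinj⟩), Finset.sum_map]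
  · refine Finset.sum_congr rfl fun s hs => ?_
    have hs' := Finset.mem_range.mp hs
    simp only [Function.Embedding.coeFn_mk]
    rw [normalE_basisVec_of_neg (by omega) (Maya.mem_vac.mpr (by omega))
      (fun h => by have := Maya.mem_vac.mp h; omega)]
    have e1 : wedgeSign (-1 - (s : ℤ) - -(m : ℤ)) Maya.vac = (-1) ^ (∅ : Finset ℤ).card := by
      refine wedgeSign_eq_of_coe _ fun x => ?_
      simp only [Maya.mem_vac, Finset.notMem_empty, iff_false]
      omega
    -- The larger factors are the `s` vacuum factors above the hole together with the one just
    -- inserted; the extra sign cancels the minus of the normal ordering at a negative index.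
    have e2 : wedgeSign (-1 - (s : ℤ)) (Maya.vac.insert (-1 - (s : ℤ) - -(m : ℤ))) =
        (-1) ^ (Insert.insert (-1 - (s : ℤ) - -(m : ℤ)) (Finset.Ioo (-1 - (s : ℤ)) 0)).card := by
      refine wedgeSign_eq_of_coe _ fun x => ?_
      simp only [Maya.mem_insert, Maya.mem_vac, Finset.mem_insert, Finset.mem_Ioo]
      omega
    have e3 : (Insert.insert (-1 - (s : ℤ) - -(m : ℤ)) (Finset.Ioo (-1 - (s : ℤ)) 0)).card =
        s + 1 := by
      rw [Finset.card_insert_of_notMem (by simp only [Finset.mem_Ioo]; omega), Int.card_Ioo]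
      omega
    have e4 : (Maya.vac.insert (-1 - (s : ℤ) - -(m : ℤ))).erase (-1 - (s : ℤ)) = hook m s := by
      apply Subtype.ext
      ext x
      rw [Maya.mem_erase, Maya.mem_insert, Maya.mem_vac, mem_hook]
      omega
    rw [e1, e2, e3, e4, Finset.card_empty, pow_zero, one_mul, pow_succ]
    simp
  · intro l hl
    by_contra h
    refine hl (normalE_basisVec_eq_zero (by omega) ?_)
    simp only [Finset.coe_map, Function.Embedding.coeFn_mk, Finset.coe_range, Set.mem_image,
      Set.mem_Iio, not_exists, not_and] at h
    simp only [Maya.mem_vac]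
    by_contra hc
    exact h (-1 - l).toNat (by omega) (by omega)

theorem finsum_ite_eq_const {ι M : Type*} [AddCommMonoid M] [DecidableEq ι] (a : ι) (v : M) :
    ∑ᶠ l : ι, (if l = a then v else 0) = v := by
  rw [finsum_eq_single _ a fun x hx => if_neg hx, if_pos rfl]

theorem finite_support_ite_eq {ι M : Type*} [AddCommMonoid M] [DecidableEq ι] (a : ι) (v : M) :
    (Function.support fun l : ι => if l = a then v else 0).Finite := by
  refine (Set.finite_singleton a).subset fun l hl => ?_
  by_contra h
  exact hl (if_neg h)

/-- A ribbon of `k` boxes can leave a hook from the arm, as the whole hook, or from the leg. The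
first two cases move the particle at `m - 1 - s`, to a nonnegative position or into the hole; the
third fills the hole at `-1 - s` from `-1 - s + k`, jumping over `k - 1` factors. -/
theorem alpha_hook {m s k : ℕ} (hs : s < m) (hk : 0 < k) :
    alpha (k : ℤ) (basisVec (hook m s)) =
      ((if s + k < m then basisVec (hook (m - k) s) else 0) +
        (if k = m then ((-1 : Coef) ^ s) • basisVec Maya.vac else 0)) +
      (if k ≤ s then (-(-1 : Coef) ^ k) • basisVec (hook (m - k) (s - k)) else 0) := by
  classical
  rw [alpha, opOfBasis_basisVec]
  set X : Wedge := (if s + k < m then basisVec (hook (m - k) s) else 0) +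
        (if k = m then ((-1 : Coef) ^ s) • basisVec Maya.vac else 0) with hX
  set Y : Wedge := if k ≤ s then (-(-1 : Coef) ^ k) • basisVec (hook (m - k) (s - k)) else 0
    with hY
  have key : ∀ l : ℤ, normalE (l - k) l (basisVec (hook m s)) =
      (if l = (m : ℤ) - 1 - s then X else 0) + (if l = -1 - (s : ℤ) + k then Y else 0) := by
    intro l
    have hne : l - k ≠ l := by omega
    by_cases h1 : l = (m : ℤ) - 1 - s
    · have hmem : l ∈ (hook m s).1 := mem_hook.mpr (Or.inl h1)
      -- The two special values of `l` coincide only for `k = m`, where `k ≤ s` fails; the move into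
      -- the particle's own hole is not counted twice.
      have hY0 : (if l = -1 - (s : ℤ) + k then Y else 0) = 0 := by
        split_ifs with h2
        · rw [hY, if_neg (by omega)]
        · rfl
      have w1 : wedgeSign l (hook m s) = 1 := by
        rw [wedgeSign_eq_of_coe ∅, Finset.card_empty, pow_zero]
        intro x
        simp only [mem_hook, Finset.notMem_empty, iff_false]
        omega
      rw [hY0, add_zero, if_pos h1, hX]
      rcases lt_or_ge (s + k) m with h2 | h2
      · rw [if_pos h2, if_neg (by omega), add_zero,
          normalE_basisVec_of_nonneg (by omega) hmem
            (fun h => by have := mem_hook.mp h; omega), w1,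
          wedgeSign_eq_of_coe (Finset.Ioo (l - k) 0)]
        · rw [Finset.card_eq_zero.mpr (Finset.Ioo_eq_empty (by omega)), pow_zero, one_mul, one_smul]
          congr 1
          apply Subtype.ext
          ext x
          rw [Maya.mem_insert, Maya.mem_erase, mem_hook, mem_hook]
          omega
        · intro x
          rw [Maya.mem_erase, mem_hook, Finset.mem_Ioo]
          omega
      · rw [if_neg (by omega)]
        by_cases h3 : k = m
        · rw [if_pos h3, zero_add, normalE_basisVec_of_nonneg (by omega) hmem
            (fun h => by have := mem_hook.mp h; omega), w1,
          wedgeSign_eq_of_coe (Finset.Ioo (l - k) 0)]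
          · rw [Int.card_Ioo, one_mul]
            congr 1
            · congr 1; omega
            · congr 1
              apply Subtype.ext
              ext x
              rw [Maya.mem_insert, Maya.mem_erase, mem_hook, Maya.mem_vac]
              omega
          · intro x
            rw [Maya.mem_erase, mem_hook, Finset.mem_Ioo]
            omega
        · rw [if_neg h3, zero_add]
          exact normalE_basisVec_eq_zero hne (Or.inr (mem_hook.mpr (by omega)))
    · rw [if_neg h1, zero_add]
      by_cases h2 : l = -1 - (s : ℤ) + k
      · rw [if_pos h2, hY]
        by_cases h3 : k ≤ s
        · rw [if_pos h3, normalE_basisVec_of_neg (by omega) (mem_hook.mpr (by omega))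
            (fun h => by have := mem_hook.mp h; omega),
            wedgeSign_eq_of_coe (Insert.insert ((m : ℤ) - 1 - s) (Finset.Ioo (l - k) 0)),
            wedgeSign_eq_of_coe (Insert.insert ((m : ℤ) - 1 - s) (Finset.Ioo l 0)),
            Finset.card_insert_of_notMem (by simp only [Finset.mem_Ioo]; omega),
            Finset.card_insert_of_notMem (by simp only [Finset.mem_Ioo]; omega), Int.card_Ioo,
            Int.card_Ioo]
          · congr 1
            · obtain ⟨r, rfl⟩ := Nat.exists_eq_add_of_le h3
              have e1 : (0 - (l - k) - 1).toNat = k + r := by omega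
              have e2 : (0 - l - 1).toNat = r := by omega
              rw [e1, e2]
              have : ((-1 : Coef) ^ r) * (-1) ^ r = 1 := by
                rw [← pow_add, Even.neg_one_pow ⟨_, rfl⟩]
              simp only [pow_add, pow_one]
              linear_combination (-(-1 : Coef) ^ k) * this
            · congr 1
              apply Subtype.ext
              ext x
              rw [Maya.mem_erase, Maya.mem_insert, mem_hook, mem_hook]
              omega
          · intro x
            rw [Maya.mem_insert, mem_hook, Finset.mem_insert, Finset.mem_Ioo]
            omega
          · intro x
            rw [mem_hook, Finset.mem_insert, Finset.mem_Ioo]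
            omega
        · rw [if_neg h3]
          refine normalE_basisVec_eq_zero hne (Or.inl fun h => ?_)
          have := mem_hook.mp h
          omega
      · rw [if_neg h2]
        refine normalE_basisVec_eq_zero hne ?_
        simp only [mem_hook]
        omega
  rw [finsum_congr key, finsum_add_distrib (finite_support_ite_eq _ _) (finite_support_ite_eq _ _),
    finsum_ite_eq_const, finsum_ite_eq_const]

theorem alpha_vac {k : ℕ} (hk : 0 < k) : alpha (k : ℤ) (basisVec Maya.vac) = 0 := by
  rw [alpha, opOfBasis_basisVec]
  refine finsum_eq_zero_of_forall_eq_zero fun l => normalE_basisVec_eq_zero (by omega) ?_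
  simp only [Maya.mem_vac]
  omega

theorem eigF2_hook {m s : ℕ} (hs : s < m) :
    eigF2 (hook m s) = (m : ℂ) * ((m : ℂ) - 1 - 2 * s) / 2 := by
  classical
  have key : ∀ n : ℤ, ((n : ℂ) + 1 / 2) ^ 2 / 2 *
      (if 0 ≤ n then (if n ∈ (hook m s).1 then 1 else 0)
        else (if n ∈ (hook m s).1 then 0 else -1)) =
      (if n = (m : ℤ) - 1 - s then (((m : ℂ) - 1 - s) + 1 / 2) ^ 2 / 2 else 0) +
      (if n = -1 - (s : ℤ) then -((-1 - (s : ℂ)) + 1 / 2) ^ 2 / 2 else 0) := by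
    intro n
    by_cases h1 : n = (m : ℤ) - 1 - s
    · rw [if_pos (by omega), if_pos (mem_hook.mpr (Or.inl h1)), if_pos h1,
        if_neg (by omega), h1]
      push_cast
      ring
    · rw [if_neg h1]
      by_cases h2 : n = -1 - (s : ℤ)
      · rw [if_neg (by omega), if_neg, if_pos h2, h2]
        · push_cast
          ring
        · intro h
          have := mem_hook.mp h
          omega
      · rw [if_neg h2]
        by_cases h3 : 0 ≤ n
        · rw [if_pos h3, if_neg]
          · ring
          · intro h
            have := mem_hook.mp h
            omega
        · rw [if_neg h3, if_pos (mem_hook.mpr (by omega))]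
          ring
  rw [(opF2_basisVec _).1, finsum_congr key,
    finsum_add_distrib (finite_support_ite_eq _ _) (finite_support_ite_eq _ _),
    finsum_ite_eq_const, finsum_ite_eq_const]
  ring

theorem eigF2_vac : eigF2 Maya.vac = 0 := by
  rw [(opF2_basisVec _).1]
  refine finsum_eq_zero_of_forall_eq_zero fun n => ?_
  by_cases h : 0 ≤ n
  · rw [if_pos h, if_neg (fun hm => by have := Maya.mem_vac.mp hm; omega), mul_zero]
  · rw [if_neg h, if_pos (Maya.mem_vac.mpr (by omega)), mul_zero]

/-! ### The annihilation operators on hook vectors -/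

theorem expHbar_add (c d : ℂ) : expHbar (c + d) = expHbar c * expHbar d := by
  unfold expHbar
  rw [← PowerSeries.exp_mul_exp_eq_exp_add, map_mul]
  rfl

theorem expHbar_zero : expHbar 0 = 1 := by
  unfold expHbar
  rw [PowerSeries.rescale_zero, RingHom.comp_apply, PowerSeries.constantCoeff_exp, map_one, map_one]
  rfl

theorem expHbar_pow (c : ℂ) (n : ℕ) : expHbar c ^ n = expHbar (n * c) := by
  induction n with
  | zero => rw [pow_zero, Nat.cast_zero, zero_mul, expHbar_zero]
  | succ n ih => rw [pow_succ, ih, ← expHbar_add]; congr 1; push_cast; ring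

/-- The vectors `∑_s (-y)^s |hook m s⟩`, with the normalization at `m = 0` that makes
`alpha_hookVec` uniform. -/
def hookVec (y : Coef) (m : ℕ) : Wedge :=
  if m = 0 then (1 - y)⁻¹ • basisVec Maya.vac
  else ∑ s ∈ Finset.range m, ((-y) ^ s) • basisVec (hook m s)

theorem hookVec_zero (y : Coef) : hookVec y 0 = (1 - y)⁻¹ • basisVec Maya.vac := if_pos rfl

theorem hookVec_of_pos (y : Coef) {m : ℕ} (hm : 0 < m) :
    hookVec y m = ∑ s ∈ Finset.range m, ((-y) ^ s) • basisVec (hook m s) := if_neg hm.ne'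

theorem hookVec_apply_vac (y : Coef) (m : ℕ) :
    hookVec y m Maya.vac = if m = 0 then (1 - y)⁻¹ else 0 := by
  unfold hookVec
  split_ifs with h
  · simp [basisVec]
  · rw [Finsupp.finsetSum_apply]
    refine Finset.sum_eq_zero fun s hs => ?_
    rw [Finsupp.smul_apply, basisVec, Finsupp.single_eq_of_ne
      (hook_ne_vac (Finset.mem_range.mp hs)).symm, smul_zero]

/-- Arm removals keep `s` and reproduce the vector with coefficient `1`; leg removals shift `s` by
`k` and contribute `-y ^ k`. For `k = m` only the vacuum is left, with coefficient the geometric sum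
`(1 - y ^ m)/(1 - y)`, which explains the normalization of `hookVec y 0`. -/
theorem alpha_hookVec {y : Coef} (hy : y ≠ 1) {m k : ℕ} (hk : 0 < k) :
    alpha (k : ℤ) (hookVec y m) = if k ≤ m then (1 - y ^ k) • hookVec y (m - k) else 0 := by
  rcases Nat.eq_zero_or_pos m with rfl | hm
  · rw [hookVec_zero, map_smul, alpha_vac hk, smul_zero, if_neg (by omega)]
  rw [hookVec_of_pos y hm, map_sum]
  have h1 : ∀ s ∈ Finset.range m, alpha (k : ℤ) (((-y) ^ s) • basisVec (hook m s)) =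
      ((if s + k < m then ((-y) ^ s) • basisVec (hook (m - k) s) else 0) +
        (if k = m then (y ^ s) • basisVec Maya.vac else 0)) +
      (if k ≤ s then ((-y) ^ s * (-(-1 : Coef) ^ k)) • basisVec (hook (m - k) (s - k)) else 0) := by
    intro s hs
    rw [map_smul, alpha_hook (Finset.mem_range.mp hs) hk, smul_add, smul_add]
    simp only [smul_ite, smul_zero, smul_smul]
    rw [← mul_pow]
    simp
  rw [Finset.sum_congr rfl h1, Finset.sum_add_distrib, Finset.sum_add_distrib]
  rcases lt_trichotomy k m with h | h | h
  · obtain ⟨r, rfl⟩ := Nat.exists_eq_add_of_lt h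
    have e : k + r + 1 - k = r + 1 := by omega
    rw [if_pos h.le, e, hookVec_of_pos y (Nat.succ_pos r),
      Finset.sum_eq_zero (s := Finset.range (k + r + 1)) (f := fun s => if k = k + r + 1 then _ else _)
        (fun s _ => if_neg (by omega)), add_zero, sub_smul, one_smul]
    have hA : (∑ s ∈ Finset.range (k + r + 1),
        if s + k < k + r + 1 then ((-y) ^ s) • basisVec (hook (r + 1) s) else 0) =
        ∑ s ∈ Finset.range (r + 1), ((-y) ^ s) • basisVec (hook (r + 1) s) := by
      rw [← Finset.sum_filter]
      refine Finset.sum_congr ?_ fun _ _ => rfl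
      ext s
      simp only [Finset.mem_filter, Finset.mem_range]
      omega
    have hB : (∑ s ∈ Finset.range (k + r + 1), if k ≤ s then
        ((-y) ^ s * (-(-1 : Coef) ^ k)) • basisVec (hook (r + 1) (s - k)) else 0) =
        -(y ^ k • ∑ s ∈ Finset.range (r + 1), ((-y) ^ s) • basisVec (hook (r + 1) s)) := by
      rw [add_assoc, Finset.sum_range_add, Finset.sum_eq_zero, zero_add, Finset.smul_sum,
        ← Finset.sum_neg_distrib]
      · refine Finset.sum_congr rfl fun s _ => ?_
        rw [if_pos (Nat.le_add_right _ _), Nat.add_sub_cancel_left, smul_smul, ← neg_smul]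
        congr 1
        have : ((-1 : Coef) ^ k) * (-1) ^ k = 1 := by
          rw [← pow_add, Even.neg_one_pow ⟨_, rfl⟩]
        rw [pow_add, neg_pow y k]
        linear_combination (-(y ^ k * (-y) ^ s)) * this
      · intro s hs
        exact if_neg (not_le.mpr (Finset.mem_range.mp hs))
    rw [hA, hB, sub_eq_add_neg]
  · subst h
    rw [if_pos le_rfl, Nat.sub_self, hookVec_zero,
      Finset.sum_eq_zero (fun s _ => if_neg (by omega)), zero_add,
      Finset.sum_eq_zero (s := Finset.range k) (f := fun s => if k ≤ s then _ else _)
        (fun s hs => if_neg (not_le.mpr (Finset.mem_range.mp hs))), add_zero]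
    simp only [if_true]
    rw [← Finset.sum_smul, smul_smul, ← div_eq_mul_inv, geom_sum_eq hy, ← neg_sub (y ^ k) 1,
      ← neg_sub y 1, neg_div_neg_eq]
  · rw [if_neg (by omega), Finset.sum_eq_zero (fun s _ => if_neg (by omega)), zero_add,
      Finset.sum_eq_zero (fun s _ => if_neg (by omega)), zero_add,
      Finset.sum_eq_zero (fun s hs => if_neg ?_)]
    have := Finset.mem_range.mp hs
    omega

/-- Replaces the infinite sum of modes by one finite combination of linear maps, the same for all
hooks with `m` boxes, so that it can be applied to their linear combinations. -/
theorem annihilation_basisVec {S : Maya} {m : ℕ} (ℓ : ℂ)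
    (h : ∀ k : ℕ, m < k → alpha (k : ℤ) (basisVec S) = 0) :
    annihilation ℓ (basisVec S) = (∑ k ∈ Finset.range m,
      (pStar ℓ k.succPNat / ((k + 1 : ℕ) : Coef)) • alpha ((k + 1 : ℕ) : ℤ)) (basisVec S) := by
  rw [annihilation, opOfBasis_basisVec,
    finsum_eq_sum_of_support_subset (s := (Finset.range m).map ⟨_, Nat.succPNat_injective⟩),
    Finset.sum_map, LinearMap.sum_apply]
  · rfl
  · intro i hi
    by_contra hc
    refine hi ?_
    have hi1 : m < (i : ℕ) := by
      by_contra hle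
      refine hc ?_
      rw [Finset.mem_coe, Finset.mem_map]
      exact ⟨i.natPred, Finset.mem_range.mpr (by have := i.pos; have := i.natPred_add_one; omega),
        PNat.succPNat_natPred i⟩
    simp only
    rw [h _ hi1, smul_zero]

/-- The series `∑_i p*_i (1 - y^i) t^i / i`. -/
def hookSeries (ℓ : ℂ) (y : Coef) : PowerSeries Coef :=
  PowerSeries.mk fun k => pStar ℓ k.toPNat' / (k : Coef) * (1 - y ^ k)

theorem constantCoeff_hookSeries (ℓ : ℂ) (y : Coef) :
    PowerSeries.constantCoeff (hookSeries ℓ y) = 0 := by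
  rw [← PowerSeries.coeff_zero_eq_constantCoeff_apply, hookSeries, PowerSeries.coeff_mk]
  -- The factor `1 - y ^ 0` vanishes, so the convention `0.toPNat' = 1` has no effect.
  simp

/-- With `m` read as an exponent of `t`, the operator becomes multiplication by `hookSeries`, so its
iterates become powers of that series. -/
theorem annihilation_hookVec (ℓ : ℂ) {y : Coef} (hy : y ≠ 1) (m : ℕ) :
    annihilation ℓ (hookVec y m) = ∑ p ∈ Finset.HasAntidiagonal.antidiagonal m,
      PowerSeries.coeff p.1 (hookSeries ℓ y) • hookVec y p.2 := by
  have h1 : annihilation ℓ (hookVec y m) = (∑ k ∈ Finset.range m,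
      (pStar ℓ k.succPNat / ((k + 1 : ℕ) : Coef)) • alpha ((k + 1 : ℕ) : ℤ)) (hookVec y m) := by
    rcases Nat.eq_zero_or_pos m with rfl | hm
    · rw [hookVec_zero, map_smul, map_smul, annihilation_basisVec (m := 0)]
      intro k hk
      exact alpha_vac hk
    · rw [hookVec_of_pos y hm, map_sum, map_sum]
      refine Finset.sum_congr rfl fun s hs => ?_
      have hs' := Finset.mem_range.mp hs
      rw [map_smul, map_smul, annihilation_basisVec (m := m)]
      intro k hk
      rw [alpha_hook hs' (by omega), if_neg (by omega), if_neg (by omega), if_neg (by omega)]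
      simp
  rw [h1, LinearMap.sum_apply, Finset.Nat.sum_antidiagonal_eq_sum_range_succ_mk,
    Finset.sum_range_succ']
  have h0 : PowerSeries.coeff 0 (hookSeries ℓ y) = 0 := by
    rw [PowerSeries.coeff_zero_eq_constantCoeff_apply, constantCoeff_hookSeries]
  rw [h0, zero_smul, add_zero]
  refine Finset.sum_congr rfl fun k hk => ?_
  have hk' := Finset.mem_range.mp hk
  rw [LinearMap.smul_apply, alpha_hookVec hy (Nat.succ_pos k), if_pos (by omega), smul_smul,
    hookSeries, PowerSeries.coeff_mk]
  rfl

/-- The series has no constant term, so each application lowers the number of boxes. This makes the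
exponential a finite sum on `hookVec y m`. -/
theorem annihilation_pow_hookVec_eq_zero (ℓ : ℂ) {y : Coef} (hy : y ≠ 1) {n m : ℕ} (h : m < n) :
    (annihilation ℓ ^ n) (hookVec y m) = 0 := by
  induction n generalizing m with
  | zero => omega
  | succ n ih =>
    rw [pow_succ, Module.End.mul_apply, annihilation_hookVec ℓ hy, map_sum]
    refine Finset.sum_eq_zero fun p hp => ?_
    rw [Finset.HasAntidiagonal.mem_antidiagonal] at hp
    rw [map_smul]
    rcases Nat.eq_zero_or_pos p.1 with h0 | h0
    · rw [h0, PowerSeries.coeff_zero_eq_constantCoeff_apply, constantCoeff_hookSeries, zero_smul]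
    · rw [ih (by omega), smul_zero]

theorem annihilation_pow_hookVec_apply_vac (ℓ : ℂ) {y : Coef} (hy : y ≠ 1) (n m : ℕ) :
    (annihilation ℓ ^ n) (hookVec y m) Maya.vac =
      PowerSeries.coeff m (hookSeries ℓ y ^ n) * (1 - y)⁻¹ := by
  induction n generalizing m with
  | zero =>
    rw [pow_zero, pow_zero, Module.End.one_apply, hookVec_apply_vac, PowerSeries.coeff_one]
    split_ifs <;> simp
  | succ n ih =>
    rw [pow_succ, Module.End.mul_apply, annihilation_hookVec ℓ hy, map_sum,
      Finsupp.finsetSum_apply, pow_succ', PowerSeries.coeff_mul, Finset.sum_mul]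
    refine Finset.sum_congr rfl fun p _ => ?_
    rw [map_smul, Finsupp.smul_apply, ih, smul_eq_mul, mul_assoc]

theorem iterate_pointwise (T : Module.End Coef Wedge) (n : ℕ) (Φ : State) (μ : ℕ+ →₀ ℕ) :
    ((fun (Φ : State) ν => T (Φ ν))^[n] Φ) μ = (T ^ n) (Φ μ) := by
  induction n with
  | zero => rfl
  | succ n ih => rw [Function.iterate_succ_apply', ih, pow_succ', Module.End.mul_apply]

theorem expOp_annihilation_hookVec (ℓ : ℂ) {y : Coef} (hy : y ≠ 1) (Φ : State) (μ : ℕ+ →₀ ℕ)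
    (c : Coef) (m : ℕ) (hΦ : Φ μ = c • hookVec y m) :
    expOp (fun Φ ν => annihilation ℓ (Φ ν)) Φ μ Maya.vac =
      c * (PowerSeries.coeff m ((PowerSeries.exp Coef).subst (hookSeries ℓ y)) * (1 - y)⁻¹) := by
  unfold expOp
  have hsub : PowerSeries.HasSubst (hookSeries ℓ y) :=
    PowerSeries.HasSubst.of_constantCoeff_zero' (constantCoeff_hookSeries ℓ y)
  have hfin : (Function.support fun n : ℕ => ((n.factorial : Coef)⁻¹) •
      ((fun (Φ : State) ν => annihilation ℓ (Φ ν))^[n] Φ) μ).Finite := by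
    refine (Finset.range (m + 1)).finite_toSet.subset fun n hn => ?_
    by_contra h
    refine hn ?_
    simp only [Finset.coe_range, Set.mem_Iio, not_lt] at h
    simp only
    rw [iterate_pointwise, hΦ, map_smul, annihilation_pow_hookVec_eq_zero ℓ hy (by omega),
      smul_zero, smul_zero]
  -- Taking the vacuum coefficient commutes with the sum over `n` because its support is finite; a
  -- `finsum` of infinite support would be the default value `0`.
  have hm := AddMonoidHom.map_finsum
    (Finsupp.applyAddHom Maya.vac : Wedge →+ Coef) hfin
  simp only [Finsupp.applyAddHom_apply] at hm
  rw [hm, PowerSeries.coeff_subst' hsub, finsum_mul,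
    mul_finsum]
  refine finsum_congr fun n => ?_
  rw [iterate_pointwise, hΦ, map_smul, Finsupp.smul_apply, Finsupp.smul_apply,
    annihilation_pow_hookVec_apply_vac ℓ hy, PowerSeries.coeff_exp]
  simp only [smul_eq_mul, one_div, map_inv₀, map_natCast]
  ring

/-! ### The one-point function -/

theorem creation_zero (P : ℤ) (Q : ℕ) (ℓ : ℂ) (Φ : State) : creation P Q ℓ Φ 0 = 0 := by
  simp [creation]

theorem creation_single (P : ℤ) (Q : ℕ) (ℓ : ℂ) (Φ : State) (m : ℕ+) :
    creation P Q ℓ Φ (Finsupp.single m 1) =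
      Coef.const ((Q : ℂ) * powA ℓ (slope P Q * (m : ℕ)) / ((m : ℕ) : ℂ)) •
        alpha (-((m : ℕ) : ℤ)) (Φ 0) := by
  rw [creation, Finsupp.support_single _ one_ne_zero, Finset.sum_singleton, tsub_self]

theorem vacState_zero : vacState 0 = basisVec Maya.vac := if_pos rfl

theorem expOp_creation_zero (P : ℤ) (Q : ℕ) (ℓ : ℂ) :
    expOp (creation P Q ℓ) vacState 0 = basisVec Maya.vac := by
  rw [expOp, finsum_eq_single _ 0]
  · simp [vacState_zero]
  · intro n hn
    obtain ⟨k, rfl⟩ := Nat.exists_eq_succ_of_ne_zero hn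
    rw [Function.iterate_succ_apply', creation_zero, smul_zero]

/-- Each application of `creation` consumes one variable, so in degree one only the linear term of
the exponential survives. -/
theorem expOp_creation_single (P : ℤ) (Q : ℕ) (ℓ : ℂ) (m : ℕ+) :
    expOp (creation P Q ℓ) vacState (Finsupp.single m 1) =
      Coef.const ((Q : ℂ) * powA ℓ (slope P Q * (m : ℕ)) / ((m : ℕ) : ℂ)) •
        alpha (-((m : ℕ) : ℤ)) (basisVec Maya.vac) := by
  rw [expOp, finsum_eq_single _ 1]
  · rw [Function.iterate_one, creation_single, vacState_zero]
    simp
  · intro n hn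
    rcases n with _ | _ | k
    · have : vacState (Finsupp.single m 1) = 0 := if_neg (by simp)
      rw [Function.iterate_zero, id, this, smul_zero]
    · exact absurd rfl hn
    · rw [Function.iterate_succ_apply', creation_single, Function.iterate_succ_apply',
        creation_zero, map_zero, smul_zero, smul_zero]

theorem expF2_basisVec (P : ℤ) (Q : ℕ) (S : Maya) :
    expF2 P Q (basisVec S) = expHbar (slope P Q * eigF2 S) • basisVec S :=
  opOfBasis_basisVec _ S

theorem Zext_zero (P : ℤ) (Q : ℕ) (ℓ : ℂ) : Zext P Q ℓ 0 = 1 := by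
  rw [Zext, expOp, finsum_eq_single _ 0]
  · rw [Function.iterate_zero, id, expOp_creation_zero, expF2_basisVec, eigF2_vac, mul_zero,
      expHbar_zero]
    simp [basisVec]
  · intro n hn
    obtain ⟨k, rfl⟩ := Nat.exists_eq_succ_of_ne_zero hn
    rw [iterate_pointwise, expOp_creation_zero, expF2_basisVec, map_smul, pow_succ,
      Module.End.mul_apply, annihilation_basisVec (m := 0) ℓ fun k hk => alpha_vac hk]
    simp

/-- The exponent `b m (m - 1 - 2s)/2` splits into `b m (m - 1)/2` and `-b m s`; the second part
turns the leg length into a power of `y`. -/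
theorem expF2_alpha_neg_vac (P : ℤ) (Q : ℕ) {m : ℕ} (hm : 0 < m) :
    expF2 P Q (alpha (-(m : ℤ)) (basisVec Maya.vac)) =
      expHbar (slope P Q * m * (m - 1) / 2) • hookVec (expHbar (-(slope P Q * m))) m := by
  rw [alpha_neg_vac hm, map_sum, hookVec_of_pos _ hm, Finset.smul_sum]
  refine Finset.sum_congr rfl fun s hs => ?_
  rw [map_smul, expF2_basisVec, eigF2_hook (Finset.mem_range.mp hs), smul_smul, smul_smul,
    neg_pow (expHbar _), expHbar_pow, mul_left_comm, ← expHbar_add]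
  congr 3
  ring

theorem Zext_single (P : ℤ) (Q : ℕ) (ℓ : ℂ) (m : ℕ+)
    (hy : expHbar (-(slope P Q * (m : ℕ))) ≠ 1) :
    Zext P Q ℓ (Finsupp.single m 1) =
      Coef.const ((Q : ℂ) * powA ℓ (slope P Q * (m : ℕ)) / ((m : ℕ) : ℂ)) *
        expHbar (slope P Q * (m : ℕ) * ((m : ℕ) - 1) / 2) *
      (PowerSeries.coeff m ((PowerSeries.exp Coef).subst
        (hookSeries ℓ (expHbar (-(slope P Q * (m : ℕ)))))) *
          (1 - expHbar (-(slope P Q * (m : ℕ))))⁻¹) := by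
  rw [Zext]
  refine expOp_annihilation_hookVec ℓ hy _ _ _ m ?_
  rw [expOp_creation_single, map_smul, expF2_alpha_neg_vac P Q m.pos, smul_smul]

theorem coeff_single_mul_of_constantCoeff_eq_zero {σ R : Type*} [CommSemiring R]
    {f g : MvPowerSeries σ R} (hf : MvPowerSeries.constantCoeff f = 0)
    (hg : MvPowerSeries.constantCoeff g = 0) (i : σ) :
    MvPowerSeries.coeff (Finsupp.single i 1) (f * g) = 0 := by
  classical
  rw [MvPowerSeries.coeff_mul]
  refine Finset.sum_eq_zero fun p hp => ?_
  rw [Finset.HasAntidiagonal.mem_antidiagonal] at hp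
  by_cases h1 : p.1 = 0
  · rw [h1, MvPowerSeries.coeff_zero_eq_constantCoeff_apply, hf, zero_mul]
  · have h2 : p.2 = 0 := by
      ext j
      obtain ⟨k, hk⟩ := Finsupp.ne_iff.mp h1
      have hk' : p.1 k ≠ 0 := hk
      have e1 : p.1 k + p.2 k = Finsupp.single i 1 k := by rw [← hp]; rfl
      have e2 : p.1 j + p.2 j = Finsupp.single i 1 j := by rw [← hp]; rfl
      rw [Finsupp.single_apply] at e1 e2
      rw [Finsupp.zero_apply]
      split_ifs at e1 e2 with h3 h4 h4
      · have : j = k := h4.symm.trans h3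
        subst this
        omega
      all_goals omega
    rw [h2, MvPowerSeries.coeff_zero_eq_constantCoeff_apply, hg, mul_zero]

/-- `log (1 + f) = f + O(f²)`, and powers of `f` from the square on have no terms of degree one. -/
theorem coeff_single_log_subst {σ R : Type*} [CommRing R] [Algebra ℚ R]
    {f : MvPowerSeries σ R} (hf : MvPowerSeries.constantCoeff f = 0) (i : σ) :
    MvPowerSeries.coeff (Finsupp.single i 1) ((PowerSeries.log R).subst f) =
      MvPowerSeries.coeff (Finsupp.single i 1) f := by
  rw [PowerSeries.coeff_subst (PowerSeries.HasSubst.of_constantCoeff_zero hf),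
    finsum_eq_single _ 1]
  · rw [PowerSeries.coeff_one_log, pow_one, one_smul]
  · intro n hn
    rcases n with _ | _ | k
    · simp
    · exact absurd rfl hn
    · rw [pow_succ, coeff_single_mul_of_constantCoeff_eq_zero _ hf, smul_zero]
      rw [pow_succ, map_mul, hf, mul_zero]

theorem correlator_zero_single (P : ℤ) (Q : ℕ) (ℓ : ℂ) (m : ℕ+) :
    correlator P Q ℓ 0 [m] = Coef.coeffHbar (-1) (Zext P Q ℓ (Finsupp.single m 1)) := by
  have h0 : MvPowerSeries.constantCoeff (Zext P Q ℓ - 1) = 0 := by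
    rw [map_sub, map_one, ← MvPowerSeries.coeff_zero_eq_constantCoeff_apply]
    exact sub_eq_zero.mpr (Zext_zero P Q ℓ)
  have h1 : MvPowerSeries.constantCoeff (MvPowerSeries.pderiv Coef m (logZext P Q ℓ)) =
      Zext P Q ℓ (Finsupp.single m 1) := by
    classical
    rw [← MvPowerSeries.coeff_zero_eq_constantCoeff_apply, MvPowerSeries.coeff_pderiv, zero_add,
      logZext, coeff_single_log_subst h0, map_sub, MvPowerSeries.coeff_one,
      if_neg (by simp)]
    simp only [Finsupp.coe_zero, Pi.zero_apply, Nat.cast_zero, zero_add, mul_one, sub_zero]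
    rfl
  rw [correlator]
  simp only [List.foldr_cons, List.foldr_nil, List.length_cons, List.length_nil]
  rw [h1]
  norm_num

/-! ### The leading coefficient in `ħ` -/

/-- Power series in `ħ` inside `ℂ((ħ))`. -/
def ofHbarSeries : PowerSeries ℂ →+* Coef :=
  (HahnSeries.ofPowerSeries ℤ ℂ : PowerSeries ℂ →+* LaurentSeries ℂ)

theorem const_eq_ofHbarSeries (a : ℂ) : Coef.const a = ofHbarSeries (PowerSeries.C a) :=
  (HahnSeries.ofPowerSeries_C a).symm

theorem expHbar_eq_ofHbarSeries (c : ℂ) :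
    expHbar c = ofHbarSeries (PowerSeries.rescale c (PowerSeries.exp ℂ)) := rfl

theorem ofHbarSeries_injective : Function.Injective ofHbarSeries :=
  HahnSeries.ofPowerSeries_injective

theorem coeffHbar_neg_one_div_X (f : PowerSeries ℂ) :
    Coef.coeffHbar (-1) (ofHbarSeries f * (ofHbarSeries PowerSeries.X)⁻¹) =
      PowerSeries.constantCoeff f := by
  have hX : ofHbarSeries PowerSeries.X ≠ 0 :=
    (map_ne_zero_iff _ ofHbarSeries_injective).mpr PowerSeries.X_ne_zero
  obtain ⟨g, hg⟩ : ∃ g : LaurentSeries ℂ,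
      g = (ofHbarSeries f * (ofHbarSeries PowerSeries.X)⁻¹ : Coef) := ⟨_, rfl⟩
  have h1 : g * HahnSeries.single 1 1 = HahnSeries.ofPowerSeries ℤ ℂ f := by
    rw [← HahnSeries.ofPowerSeries_X, hg]
    exact inv_mul_cancel_right₀ hX (ofHbarSeries f)
  have h2 := HahnSeries.coeff_mul_single_add (r := (1 : ℂ)) (x := g) (a := -1) (b := 1)
  rw [h1, mul_one, neg_add_cancel] at h2
  have h3 := HahnSeries.ofPowerSeries_apply_coeff (Γ := ℤ) f 0
  rw [Nat.cast_zero, h2, PowerSeries.coeff_zero_eq_constantCoeff_apply] at h3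
  rw [← h3, hg]
  rfl

/-- The series `(exp (c ħ) - 1) / ħ`. -/
def expQuot (c : ℂ) : PowerSeries ℂ := PowerSeries.mk fun n => c ^ (n + 1) / ((n + 1).factorial : ℂ)

theorem rescale_exp_eq (c : ℂ) :
    PowerSeries.rescale c (PowerSeries.exp ℂ) = 1 + PowerSeries.X * expQuot c := by
  ext n
  rcases n with _ | n
  · simp
  · rw [PowerSeries.coeff_rescale, PowerSeries.coeff_exp, map_add, PowerSeries.coeff_succ_X_mul,
      expQuot, PowerSeries.coeff_mk, PowerSeries.coeff_one, if_neg (Nat.succ_ne_zero n)]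
    simp [div_eq_mul_inv]

theorem constantCoeff_expQuot (c : ℂ) : PowerSeries.constantCoeff (expQuot c) = c := by
  rw [← PowerSeries.coeff_zero_eq_constantCoeff_apply, expQuot, PowerSeries.coeff_mk]
  simp

theorem one_sub_expHbar_neg (c : ℂ) : 1 - expHbar (-c) =
    ofHbarSeries PowerSeries.X * ofHbarSeries (-expQuot (-c)) := by
  rw [expHbar_eq_ofHbarSeries, rescale_exp_eq, map_add, map_one, map_mul, map_neg]
  ring

theorem ofHbarSeries_ne_zero {f : PowerSeries ℂ} (hf : PowerSeries.constantCoeff f ≠ 0) :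
    ofHbarSeries f ≠ 0 := by
  refine (map_ne_zero_iff _ ofHbarSeries_injective).mpr ?_
  rintro rfl
  exact hf (map_zero _)

theorem inv_ofHbarSeries {f : PowerSeries ℂ} (hf : PowerSeries.constantCoeff f ≠ 0) :
    (ofHbarSeries f)⁻¹ = ofHbarSeries f⁻¹ := by
  refine inv_eq_of_mul_eq_one_right ?_
  rw [← map_mul, PowerSeries.mul_inv_cancel _ hf, map_one]

theorem ofHbarSeries_X_ne_zero : ofHbarSeries PowerSeries.X ≠ 0 :=
  (map_ne_zero_iff _ ofHbarSeries_injective).mpr PowerSeries.X_ne_zero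

theorem expHbar_neg_ne_one {c : ℂ} (hc : c ≠ 0) : expHbar (-c) ≠ 1 := by
  intro h
  have h1 := one_sub_expHbar_neg c
  rw [h, sub_self] at h1
  refine mul_ne_zero ofHbarSeries_X_ne_zero (ofHbarSeries_ne_zero ?_) h1.symm
  rw [map_neg, constantCoeff_expQuot, neg_neg]
  exact hc

/-- The lift of `hookSeries` to power series in `ħ`. -/
def hookSeriesHbar (ℓ c : ℂ) : PowerSeries (PowerSeries ℂ) := PowerSeries.mk fun k =>
  PowerSeries.C ((powA ℓ k - powA ℓ (-(k : ℂ))) / k) * -expQuot (-(k * c)) *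
    (expQuot ((k : ℂ) / 2) - expQuot (-((k : ℂ) / 2)))⁻¹

/-- The factor `ħ` of `1 - y ^ k` cancels the factor `ħ` in the denominator of `pStar`, so every
coefficient is regular at `ħ = 0`. -/
theorem hookSeries_eq_map (ℓ c : ℂ) :
    hookSeries ℓ (expHbar (-c)) = PowerSeries.map ofHbarSeries (hookSeriesHbar ℓ c) := by
  ext k
  rw [PowerSeries.coeff_map, hookSeries, hookSeriesHbar, PowerSeries.coeff_mk, PowerSeries.coeff_mk,
    expHbar_pow, mul_neg, one_sub_expHbar_neg, pStar]
  rcases Nat.eq_zero_or_pos k with rfl | hk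
  · simp
  have hk0 : (k : ℂ) ≠ 0 := Nat.cast_ne_zero.mpr hk.ne'
  have hG : PowerSeries.constantCoeff (expQuot ((k : ℂ) / 2) - expQuot (-((k : ℂ) / 2))) ≠ 0 := by
    rw [map_sub, constantCoeff_expQuot, constantCoeff_expQuot, sub_neg_eq_add, add_halves]
    exact hk0
  have hden : expHbar ((k : ℂ) / 2) - expHbar (-((k : ℂ) / 2)) = ofHbarSeries PowerSeries.X *
      ofHbarSeries (expQuot ((k : ℂ) / 2) - expQuot (-((k : ℂ) / 2))) := by
    rw [expHbar_eq_ofHbarSeries, expHbar_eq_ofHbarSeries, rescale_exp_eq, rescale_exp_eq]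
    simp only [map_add, map_sub, map_mul]
    ring
  have hkk : ((k.toPNat' : ℕ) : ℂ) = k := by rw [Nat.toPNat'_coe, if_pos hk]
  have hkc : Coef.const (k : ℂ) = (k : Coef) := map_natCast _ _
  rw [hkk, hden, map_mul, map_mul, ← inv_ofHbarSeries hG, ← const_eq_ofHbarSeries, map_div₀, hkc]
  have h1 := ofHbarSeries_X_ne_zero
  have h2 := ofHbarSeries_ne_zero hG
  have h3 : (k : Coef) ≠ 0 := Nat.cast_ne_zero.mpr hk.ne'
  field_simp

/-- The series `log ((1 - v t) / (1 - u t))`. -/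
def logQuotSeries (u v : ℂ) : PowerSeries ℂ := PowerSeries.mk fun k => (u ^ k - v ^ k) / k

theorem constantCoeff_logQuotSeries (u v : ℂ) :
    PowerSeries.constantCoeff (logQuotSeries u v) = 0 := by
  rw [← PowerSeries.coeff_zero_eq_constantCoeff_apply, logQuotSeries, PowerSeries.coeff_mk]
  simp

theorem hasSubst_smul_logQuotSeries (c u v : ℂ) :
    PowerSeries.HasSubst (c • logQuotSeries u v) :=
  PowerSeries.HasSubst.of_constantCoeff_zero' (by
    rw [PowerSeries.smul_eq_C_mul, map_mul, constantCoeff_logQuotSeries, mul_zero])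

theorem constantCoeff_hookSeriesHbar (ℓ c : ℂ) :
    PowerSeries.constantCoeff (hookSeriesHbar ℓ c) = 0 := by
  rw [← PowerSeries.coeff_zero_eq_constantCoeff_apply, hookSeriesHbar, PowerSeries.coeff_mk]
  simp

theorem powA_mul_nat (ℓ r : ℂ) (k : ℕ) : powA ℓ (r * k) = powA ℓ r ^ k := by
  rw [powA, powA, ← Complex.exp_nat_mul]; ring_nf

theorem powA_add (ℓ r s : ℂ) : powA ℓ (r + s) = powA ℓ r * powA ℓ s := by
  rw [powA, powA, powA, ← Complex.exp_add, add_mul]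

/-- At `ħ = 0` the ratio of `1 - e^{-kcħ}` to `e^{kħ/2} - e^{-kħ/2}` tends to `kc/k = c` for every
`k ≥ 1`. -/
theorem map_constantCoeff_hookSeriesHbar (ℓ c : ℂ) :
    PowerSeries.map PowerSeries.constantCoeff (hookSeriesHbar ℓ c) =
      c • logQuotSeries (powA ℓ 1) (powA ℓ (-1)) := by
  ext k
  rw [PowerSeries.coeff_map, PowerSeries.coeff_smul, logQuotSeries, hookSeriesHbar,
    PowerSeries.coeff_mk, PowerSeries.coeff_mk, map_mul, map_mul, PowerSeries.constantCoeff_C,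
    PowerSeries.constantCoeff_inv, map_neg, map_sub, constantCoeff_expQuot, constantCoeff_expQuot,
    constantCoeff_expQuot, ← powA_mul_nat, ← powA_mul_nat, one_mul, neg_one_mul, smul_eq_mul]
  rcases Nat.eq_zero_or_pos k with rfl | hk
  · simp
  have hk0 : (k : ℂ) ≠ 0 := Nat.cast_ne_zero.mpr hk.ne'
  rw [sub_neg_eq_add, add_halves]
  field_simp

/-- Naturality of the exponential in the coefficient ring. It is used both to pull the computation
back from `Coef` to power series in `ħ` and to set `ħ = 0` before exponentiating. -/
theorem coeff_exp_subst_map {R S : Type*} [CommRing R] [CommRing S] [Algebra ℚ R] [Algebra ℚ S]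
    (f : R →+* S) {a : PowerSeries R} (ha : PowerSeries.constantCoeff a = 0) (m : ℕ) :
    PowerSeries.coeff m ((PowerSeries.exp S).subst (PowerSeries.map f a)) =
      f (PowerSeries.coeff m ((PowerSeries.exp R).subst a)) := by
  have h := PowerSeries.map_subst (PowerSeries.HasSubst.of_constantCoeff_zero ha) (h := f)
    (PowerSeries.exp R)
  rw [PowerSeries.map_exp] at h
  rw [← PowerSeries.coeff_map]
  exact congrArg (PowerSeries.coeff m) h.symm

theorem coeff_exp_subst_rescale {R : Type*} [CommRing R] [Algebra ℚ R] (r : R) {a : PowerSeries R}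
    (ha : PowerSeries.constantCoeff a = 0) (m : ℕ) :
    PowerSeries.coeff m ((PowerSeries.exp R).subst (PowerSeries.rescale r a)) =
      r ^ m * PowerSeries.coeff m ((PowerSeries.exp R).subst a) := by
  have ha' : PowerSeries.constantCoeff (PowerSeries.rescale r a) = 0 := by
    rw [← PowerSeries.coeff_zero_eq_constantCoeff_apply, PowerSeries.coeff_rescale,
      PowerSeries.coeff_zero_eq_constantCoeff_apply, ha, mul_zero]
  have hs := PowerSeries.HasSubst.of_constantCoeff_zero' ha
  rw [PowerSeries.coeff_subst' (PowerSeries.HasSubst.of_constantCoeff_zero' ha'),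
    PowerSeries.coeff_subst' hs, ← smul_eq_mul,
    smul_finsum' _ (PowerSeries.coeff_subst_finite' hs _ _)]
  refine finsum_congr fun n => ?_
  rw [← map_pow, PowerSeries.coeff_rescale, smul_eq_mul, smul_eq_mul, smul_eq_mul]
  ring

theorem correlator_eq_coeff_exp (P : ℤ) (Q : ℕ) (hP : P ≠ 0) (hQ : 0 < Q) (ℓ : ℂ) (m : ℕ+) :
    correlator P Q ℓ 0 [m] = (Q : ℂ) / ((m : ℕ) * (slope P Q * (m : ℕ))) *
      PowerSeries.coeff m ((PowerSeries.exp ℂ).subst ((slope P Q * (m : ℕ)) •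
        logQuotSeries (powA ℓ (slope P Q + 1)) (powA ℓ (slope P Q - 1)))) := by
  set c : ℂ := slope P Q * (m : ℕ) with hc
  have hc0 : c ≠ 0 := by
    refine mul_ne_zero (div_ne_zero (Int.cast_ne_zero.mpr hP) (Nat.cast_ne_zero.mpr hQ.ne')) ?_
    exact Nat.cast_ne_zero.mpr m.ne_zero
  have hD : PowerSeries.constantCoeff (-expQuot (-c)) ≠ 0 := by
    rw [map_neg, constantCoeff_expQuot, neg_neg]
    exact hc0
  -- The prefactor `A^{bm}` is absorbed by the rescaling `t ↦ A^b t`, which turns `A^{±1}` into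
  -- `A^{b±1}`.
  have hresc : c • logQuotSeries (powA ℓ (slope P Q + 1)) (powA ℓ (slope P Q - 1)) =
      PowerSeries.rescale (powA ℓ (slope P Q)) (c • logQuotSeries (powA ℓ 1) (powA ℓ (-1))) := by
    ext k
    rw [PowerSeries.coeff_rescale, PowerSeries.coeff_smul, PowerSeries.coeff_smul, logQuotSeries,
      logQuotSeries, PowerSeries.coeff_mk, PowerSeries.coeff_mk, powA_add, sub_eq_add_neg (slope P Q) 1, powA_add,
      mul_pow, mul_pow, smul_eq_mul, smul_eq_mul]
    ring
  have hcc : PowerSeries.constantCoeff (c • logQuotSeries (powA ℓ 1) (powA ℓ (-1))) = 0 := by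
    rw [PowerSeries.smul_eq_C_mul, map_mul, constantCoeff_logQuotSeries, mul_zero]
  rw [correlator_zero_single, Zext_single P Q ℓ m (expHbar_neg_ne_one hc0), hookSeries_eq_map,
    coeff_exp_subst_map _ (constantCoeff_hookSeriesHbar ℓ c), one_sub_expHbar_neg, mul_inv,
    inv_ofHbarSeries hD, const_eq_ofHbarSeries, expHbar_eq_ofHbarSeries]
  -- The factor `x` is the inverse of `ħ` coming from `(1 - y)⁻¹`; once isolated, the other factors
  -- form a power series whose constant term is wanted.
  rw [show ∀ a b d x e : Coef, a * b * (d * (x * e)) = a * b * d * e * x by intros; ring,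
    ← map_mul, ← map_mul, ← map_mul, coeffHbar_neg_one_div_X, map_mul, map_mul, map_mul,
    PowerSeries.constantCoeff_C, rescale_exp_eq, map_add, map_mul, PowerSeries.constantCoeff_X,
    ← coeff_exp_subst_map _ (constantCoeff_hookSeriesHbar ℓ c), map_constantCoeff_hookSeriesHbar,
    PowerSeries.constantCoeff_inv, map_neg, constantCoeff_expQuot (-c), neg_neg, hresc,
    coeff_exp_subst_rescale _ hcc, map_one, powA_mul_nat]
  have hm0 : ((m : ℕ) : ℂ) ≠ 0 := Nat.cast_ne_zero.mpr m.ne_zero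
  field_simp
  ring

/-! ### The coefficients as Jacobi polynomials -/

/-- A linear first-order equation determines its solution recursively from the constant term. This
serves to identify exponentials of logarithmic series with closed forms and with Taylor series. -/
theorem eq_of_derivative_eq_mul {Y Z a : PowerSeries ℂ}
    (hY : PowerSeries.derivative ℂ Y = a * Y) (hZ : PowerSeries.derivative ℂ Z = a * Z)
    (h0 : PowerSeries.constantCoeff Y = PowerSeries.constantCoeff Z) : Y = Z := by
  ext n
  induction n using Nat.strong_induction_on with
  | _ n ih =>
    rcases n with _ | n
    · simpa using h0
    have hn : (n : ℂ) + 1 ≠ 0 := Nat.cast_add_one_ne_zero n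
    refine mul_right_cancel₀ hn ?_
    rw [← PowerSeries.coeff_derivative, ← PowerSeries.coeff_derivative, hY, hZ,
      PowerSeries.coeff_mul, PowerSeries.coeff_mul]
    refine Finset.sum_congr rfl fun p hp => ?_
    rw [Finset.HasAntidiagonal.mem_antidiagonal] at hp
    rw [ih p.2 (by omega)]

theorem derivative_exp_subst {a : PowerSeries ℂ} (ha : PowerSeries.HasSubst a) :
    PowerSeries.derivative ℂ ((PowerSeries.exp ℂ).subst a) =
      PowerSeries.derivative ℂ a * (PowerSeries.exp ℂ).subst a := by
  rw [PowerSeries.derivative_subst ha, PowerSeries.derivative_exp, mul_comm]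

theorem constantCoeff_exp_subst {a : PowerSeries ℂ} (ha : PowerSeries.constantCoeff a = 0) :
    PowerSeries.constantCoeff ((PowerSeries.exp ℂ).subst a) = 1 := by
  rw [← PowerSeries.coeff_zero_eq_constantCoeff_apply,
    PowerSeries.coeff_subst' (PowerSeries.HasSubst.of_constantCoeff_zero' ha),
    finsum_eq_single _ 0]
  · simp
  · intro n hn
    rw [PowerSeries.coeff_zero_eq_constantCoeff_apply, map_pow, ha, zero_pow hn, smul_zero]

theorem derivative_logQuotSeries (u v : ℂ) :
    (1 - PowerSeries.C u * PowerSeries.X) * (1 - PowerSeries.C v * PowerSeries.X) *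
      PowerSeries.derivative ℂ (logQuotSeries u v) = PowerSeries.C (u - v) := by
  have hG : ∀ r : ℂ, (1 - PowerSeries.C r * PowerSeries.X) * PowerSeries.mk (fun k => r ^ k) = 1 := by
    intro r
    ext n
    rw [sub_mul, one_mul, mul_assoc, map_sub, PowerSeries.coeff_C_mul, PowerSeries.coeff_one]
    rcases n with _ | n
    · simp
    · rw [PowerSeries.coeff_succ_X_mul, PowerSeries.coeff_mk, PowerSeries.coeff_mk, pow_succ,
        if_neg (Nat.succ_ne_zero n)]
      ring
  have hL : PowerSeries.derivative ℂ (logQuotSeries u v) =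
      PowerSeries.C u * PowerSeries.mk (fun k => u ^ k) -
        PowerSeries.C v * PowerSeries.mk (fun k => v ^ k) := by
    ext n
    have hn : (n : ℂ) + 1 ≠ 0 := Nat.cast_add_one_ne_zero n
    rw [PowerSeries.coeff_derivative, logQuotSeries, PowerSeries.coeff_mk, map_sub,
      PowerSeries.coeff_C_mul, PowerSeries.coeff_C_mul, PowerSeries.coeff_mk, PowerSeries.coeff_mk]
    push_cast
    field_simp
    ring
  rw [hL, map_sub]
  linear_combination (PowerSeries.C u * (1 - PowerSeries.C v * PowerSeries.X)) * hG u -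
    (PowerSeries.C v * (1 - PowerSeries.C u * PowerSeries.X)) * hG v

/-- The binomial series `(1 - u t)^(-c-1)`. -/
def risingSeries (c u : ℂ) : PowerSeries ℂ := PowerSeries.mk fun s =>
  (ascPochhammer ℂ s).eval (c + 1) / (s.factorial : ℂ) * u ^ s

/-- The binomial series `(1 - v t)^(c-1)`. -/
def fallingSeries (c v : ℂ) : PowerSeries ℂ := PowerSeries.mk fun j =>
  (ascPochhammer ℂ j).eval (c - j) / (j.factorial : ℂ) * (-v) ^ j

theorem coeff_C_mul_X_mul_derivative (r : ℂ) (f : PowerSeries ℂ) (n : ℕ) :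
    PowerSeries.coeff n (PowerSeries.C r * PowerSeries.X * PowerSeries.derivative ℂ f) =
      r * (n * PowerSeries.coeff n f) := by
  rw [mul_assoc, PowerSeries.coeff_C_mul]
  rcases n with _ | n
  · simp
  · rw [PowerSeries.coeff_succ_X_mul, PowerSeries.coeff_derivative]
    push_cast
    ring

theorem derivative_risingSeries (c u : ℂ) :
    (1 - PowerSeries.C u * PowerSeries.X) * PowerSeries.derivative ℂ (risingSeries c u) =
      PowerSeries.C ((c + 1) * u) * risingSeries c u := by
  ext n
  rw [sub_mul, one_mul, map_sub, coeff_C_mul_X_mul_derivative, PowerSeries.coeff_derivative,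
    PowerSeries.coeff_C_mul, risingSeries, PowerSeries.coeff_mk, PowerSeries.coeff_mk,
    ascPochhammer_succ_eval, Nat.factorial_succ]
  have hn : (n : ℂ) + 1 ≠ 0 := Nat.cast_add_one_ne_zero n
  have hf : (n.factorial : ℂ) ≠ 0 := Nat.cast_ne_zero.mpr n.factorial_ne_zero
  push_cast
  field_simp
  ring

theorem derivative_fallingSeries (c v : ℂ) :
    (1 - PowerSeries.C v * PowerSeries.X) * PowerSeries.derivative ℂ (fallingSeries c v) =
      PowerSeries.C (-(c - 1) * v) * fallingSeries c v := by
  ext n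
  have h1 : (ascPochhammer ℂ (n + 1)).eval (c - ((n + 1 : ℕ) : ℂ)) =
      (c - n - 1) * (ascPochhammer ℂ n).eval (c - n) := by
    rw [ascPochhammer_succ_left, Polynomial.eval_mul, Polynomial.eval_X, Polynomial.eval_comp]
    simp only [Polynomial.eval_add, Polynomial.eval_X, Polynomial.eval_one]
    push_cast
    ring_nf
  rw [sub_mul, one_mul, map_sub, coeff_C_mul_X_mul_derivative, PowerSeries.coeff_derivative,
    PowerSeries.coeff_C_mul, fallingSeries, PowerSeries.coeff_mk, PowerSeries.coeff_mk, h1,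
    Nat.factorial_succ]
  have hn : (n : ℂ) + 1 ≠ 0 := Nat.cast_add_one_ne_zero n
  have hf : (n.factorial : ℂ) ≠ 0 := Nat.cast_ne_zero.mpr n.factorial_ne_zero
  push_cast
  field_simp
  ring

/-- The series `V` is `(1 - u t)^{-c} (1 - v t)^c`, written as a polynomial times the two binomial
series. It solves the same differential equation as the exponential, and its derivative is `c (u -
v) (1 - u t)^{-c-1} (1 - v t)^{c-1}`. -/
theorem coeff_exp_smul_logQuotSeries (c u v : ℂ) (n : ℕ) :
    PowerSeries.coeff (n + 1) ((PowerSeries.exp ℂ).subst (c • logQuotSeries u v)) * (n + 1) =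
      c * (u - v) * PowerSeries.coeff n (risingSeries c u * fallingSeries c v) := by
  set R := risingSeries c u with hR
  set S := fallingSeries c v with hS
  set V := (1 - PowerSeries.C u * PowerSeries.X) * (1 - PowerSeries.C v * PowerSeries.X) *
    (R * S) with hV
  have hR' := derivative_risingSeries c u
  have hS' := derivative_fallingSeries c v
  rw [← hR] at hR'
  rw [← hS] at hS'
  have hL := derivative_logQuotSeries u v
  have dlin : ∀ r : ℂ, PowerSeries.derivative ℂ (1 - PowerSeries.C r * PowerSeries.X) =
      -PowerSeries.C r := by
    intro r
    rw [map_sub, PowerSeries.derivative_one, Derivation.leibniz, PowerSeries.derivative_X,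
      PowerSeries.derivative_C]
    simp
  have hV' : PowerSeries.derivative ℂ V = PowerSeries.C (c * (u - v)) * (R * S) := by
    rw [hV, Derivation.leibniz, Derivation.leibniz, Derivation.leibniz, dlin, dlin]
    simp only [smul_eq_mul, map_mul, map_neg, map_sub, map_add, map_one] at hR' hS' ⊢
    linear_combination (S * (1 - PowerSeries.C v * PowerSeries.X)) * hR' +
      (R * (1 - PowerSeries.C u * PowerSeries.X)) * hS'
  have hdc : PowerSeries.derivative ℂ (c • logQuotSeries u v) =
      PowerSeries.C c * PowerSeries.derivative ℂ (logQuotSeries u v) := by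
    rw [PowerSeries.smul_eq_C_mul, Derivation.leibniz, PowerSeries.derivative_C, smul_zero,
      add_zero, smul_eq_mul]
  have hBV : (PowerSeries.exp ℂ).subst (c • logQuotSeries u v) = V := by
    refine eq_of_derivative_eq_mul
      (derivative_exp_subst (hasSubst_smul_logQuotSeries c u v)) ?_ ?_
    · rw [hV', hdc, hV, map_mul]
      linear_combination (-(PowerSeries.C c * R * S)) * hL
    · rw [constantCoeff_exp_subst (by
        rw [PowerSeries.smul_eq_C_mul, map_mul, constantCoeff_logQuotSeries, mul_zero]), hV, hR, hS]
      simp only [map_mul, map_sub, map_one,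
        ← PowerSeries.coeff_zero_eq_constantCoeff_apply]
      simp [risingSeries, fallingSeries]
  rw [← PowerSeries.coeff_derivative, hBV, hV', PowerSeries.coeff_C_mul]

/-- For `α = c - (n + 1)` and `β = 1` one has `1 + α + β + n = c + 1` and `α + s + 1 = c - (n - s)`,
so the Cauchy product and the Jacobi sum agree term by term. -/
theorem coeff_rising_mul_falling (c v w : ℂ) (n : ℕ) :
    PowerSeries.coeff n (risingSeries c (w * v) * fallingSeries c v) =
      (-v) ^ n * jacobi n (c - (n + 1)) 1 (1 - 2 * w) := by
  rw [PowerSeries.coeff_mul, Finset.Nat.sum_antidiagonal_eq_sum_range_succ_mk, jacobi, ← mul_assoc,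
    Finset.mul_sum]
  refine Finset.sum_congr rfl fun s hs => ?_
  have hs' : s ≤ n := Nat.lt_succ_iff.mp (Finset.mem_range.mp hs)
  obtain ⟨j, rfl⟩ := Nat.exists_eq_add_of_le hs'
  have hch : ((s + j).choose s : ℂ) = ((s + j).factorial : ℂ) / (s.factorial * j.factorial) := by
    rw [Nat.cast_choose ℂ hs', Nat.add_sub_cancel_left]
  simp only [risingSeries, fallingSeries, PowerSeries.coeff_mk, Nat.add_sub_cancel_left]
  rw [hch]
  have e1 : 1 + (c - (((s + j : ℕ) : ℂ) + 1)) + 1 + ((s + j : ℕ) : ℂ) = c + 1 := by ring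
  have e2 : c - (((s + j : ℕ) : ℂ) + 1) + s + 1 = c - j := by push_cast; ring
  have e3 : (1 - (1 - 2 * w)) / 2 = w := by ring
  rw [e1, e2, e3, pow_add (-v), mul_pow, neg_pow v s]
  have hf : ((s + j).factorial : ℂ) ≠ 0 := Nat.cast_ne_zero.mpr (Nat.factorial_ne_zero _)
  have hs1 : ((-1 : ℂ) ^ s) * (-1) ^ s = 1 := by
    rw [← pow_add, Even.neg_one_pow ⟨_, rfl⟩]
  field_simp
  have hs2 : ((-1 : ℂ) ^ s) ^ 2 = 1 := by rw [sq, hs1]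
  simp only [hs2, mul_one]

/-- Here `c = b m`, so `c - m = m (b - 1)`, and `u = A² v` gives both the argument `1 - 2A²` and the
factor `u - v = -(1 - A²) v`. -/
theorem correlator_eq_xiOne (P : ℤ) (Q : ℕ) (hP : P ≠ 0) (hQ : 0 < Q) (ℓ : ℂ) (m : ℕ+) :
    correlator P Q ℓ 0 [m] =
      (Q : ℂ) * (1 - powA ℓ 2) / ((m : ℕ) : ℂ) ^ 2 * xiOne P Q ℓ m := by
  rw [correlator_eq_coeff_exp P Q hP hQ ℓ m, xiOne, powA_mul_nat]
  obtain ⟨n, hn⟩ : ∃ n : ℕ, (m : ℕ) = n + 1 := ⟨m.natPred, (PNat.natPred_add_one m).symm⟩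
  rw [hn]
  have hu : powA ℓ (slope P Q + 1) = powA ℓ 2 * powA ℓ (slope P Q - 1) := by
    rw [← powA_add]; ring_nf
  have hb : slope P Q ≠ 0 :=
    div_ne_zero (Int.cast_ne_zero.mpr hP) (Nat.cast_ne_zero.mpr hQ.ne')
  have hn0 : (n : ℂ) + 1 ≠ 0 := Nat.cast_add_one_ne_zero n
  have key := coeff_exp_smul_logQuotSeries (slope P Q * ((n + 1 : ℕ) : ℂ))
    (powA ℓ (slope P Q + 1)) (powA ℓ (slope P Q - 1)) n
  rw [hu, coeff_rising_mul_falling] at key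
  have e1 : ((n + 1 : ℕ) : ℂ) * (slope P Q - 1) =
      slope P Q * ((n + 1 : ℕ) : ℂ) - ((n : ℂ) + 1) := by push_cast; ring
  rw [hu, e1, Nat.add_sub_cancel, pow_succ, pow_succ]
  rw [← eq_div_iff hn0] at key
  rw [key, neg_pow]
  push_cast
  field_simp
  ring

/-! ### Lagrange inversion -/

theorem coeff_X_pow_mul_eq_zero {n m : ℕ} (h : n < m) (f : PowerSeries ℂ) :
    PowerSeries.coeff n (PowerSeries.X ^ m * f) = 0 := by
  rw [PowerSeries.coeff_X_pow_mul', if_neg (not_le.mpr h)]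

/-- Residue orthogonality: for `H = X Ψ` and `Φ = Ψ⁻¹`, the `X^n`-coefficient of
`(H^(k+1))' Φ^(n+1)` is `n + 1` for `k = n` and vanishes for `k < n`. -/
theorem coeff_derivative_pow_mul_pow {Φ Ψ : PowerSeries ℂ} (hΦ : Φ * Ψ = 1) {k n : ℕ}
    (hk : k ≤ n) :
    PowerSeries.coeff n (PowerSeries.derivative ℂ ((PowerSeries.X * Ψ) ^ (k + 1)) * Φ ^ (n + 1)) =
      if k = n then (n : ℂ) + 1 else 0 := by
  obtain ⟨j, rfl⟩ := Nat.exists_eq_add_of_le hk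
  have hdX : PowerSeries.derivative ℂ (PowerSeries.X * Ψ) =
      Ψ + PowerSeries.X * PowerSeries.derivative ℂ Ψ := by
    rw [Derivation.leibniz, PowerSeries.derivative_X, smul_eq_mul, smul_eq_mul, mul_one, add_comm]
  have hpow : ∀ i : ℕ, Ψ ^ i * Φ ^ i = 1 := fun i => by
    rw [← mul_pow, mul_comm Ψ, hΦ, one_pow]
  have e1 : PowerSeries.derivative ℂ ((PowerSeries.X * Ψ) ^ (k + 1)) * Φ ^ (k + j + 1) =
      ((k : PowerSeries ℂ) + 1) * (PowerSeries.X ^ k *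
        (Φ ^ j + PowerSeries.X * (PowerSeries.derivative ℂ Ψ * Φ ^ (j + 1)))) := by
    rw [PowerSeries.derivative_pow, hdX, Nat.add_sub_cancel, mul_pow]
    push_cast
    have h2 := hpow k
    have h3 : Φ ^ (k + j + 1) = Φ ^ k * (Φ ^ j * Φ) := by ring
    rw [h3]
    linear_combination ((k : PowerSeries ℂ) + 1) * PowerSeries.X ^ k *
      (Φ ^ j * (Φ * Ψ + PowerSeries.X * PowerSeries.derivative ℂ Ψ * Φ)) * h2 +
      ((k : PowerSeries ℂ) + 1) * PowerSeries.X ^ k * Φ ^ j * hΦ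
  have hcast : ((k : PowerSeries ℂ) + 1) = PowerSeries.C ((k : ℂ) + 1) := by simp
  rw [e1, hcast, PowerSeries.coeff_C_mul, add_comm k j, PowerSeries.coeff_X_pow_mul]
  rcases j with _ | j
  · simp
  · rw [if_neg (by omega)]
    have hd : PowerSeries.derivative ℂ Ψ * Φ = -(Ψ * PowerSeries.derivative ℂ Φ) := by
      have := congrArg (PowerSeries.derivative ℂ) hΦ
      rw [Derivation.leibniz, PowerSeries.derivative_one, smul_eq_mul, smul_eq_mul] at this
      linear_combination this
    -- The series in question is thereby `Φ^(j+1) - X (Φ^(j+1))'/(j+1)`, whose coefficient at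
    -- `X^(j+1)` is zero: a derivative has no residue.
    have h4 : ((j : PowerSeries ℂ) + 1) * (PowerSeries.derivative ℂ Ψ * Φ ^ (j + 1 + 1)) =
        -PowerSeries.derivative ℂ (Φ ^ (j + 1)) := by
      rw [PowerSeries.derivative_pow, Nat.add_sub_cancel]
      push_cast
      linear_combination ((j : PowerSeries ℂ) + 1) * Φ ^ (j + 1) * hd -
        ((j : PowerSeries ℂ) + 1) * Φ ^ j * PowerSeries.derivative ℂ Φ * hΦ
    have h5 := congrArg (PowerSeries.coeff j) h4
    have hcast' : ((j : PowerSeries ℂ) + 1) = PowerSeries.C ((j : ℂ) + 1) := by simp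
    rw [hcast', PowerSeries.coeff_C_mul, map_neg, PowerSeries.coeff_derivative] at h5
    rw [map_add, PowerSeries.coeff_succ_X_mul]
    have hj : (j : ℂ) + 1 ≠ 0 := Nat.cast_add_one_ne_zero j
    have h6 : PowerSeries.coeff j (PowerSeries.derivative ℂ Ψ * Φ ^ (j + 1 + 1)) =
        -PowerSeries.coeff (j + 1) (Φ ^ (j + 1)) := by
      refine mul_left_cancel₀ hj ?_
      rw [h5]
      ring
    rw [h6, add_neg_cancel, mul_zero]

/-- Lagrange inversion for `F = w(H)`, `H = X Ψ`. A truncated expansion with remainder suffices: the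
derivative of the remainder is divisible by `X^(n+1)`, and orthogonality selects `w (n + 1)` from
the rest. -/
theorem lagrange_coeff {Φ Ψ F ρ : PowerSeries ℂ} (hΦ : Φ * Ψ = 1) (n : ℕ) (w : ℕ → ℂ)
    (hF : F = ∑ k ∈ Finset.range (n + 2), PowerSeries.C (w k) * (PowerSeries.X * Ψ) ^ k +
      (PowerSeries.X * Ψ) ^ (n + 2) * ρ) :
    PowerSeries.coeff n (PowerSeries.derivative ℂ F * Φ ^ (n + 1)) = ((n : ℂ) + 1) * w (n + 1) := by
  rw [hF, map_add, map_sum, Finset.sum_range_succ', add_mul, map_add, add_mul, map_add,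
    Finset.sum_mul, map_sum]
  have hC : ∀ (c : ℂ) (f : PowerSeries ℂ), PowerSeries.derivative ℂ (PowerSeries.C c * f) =
      PowerSeries.C c * PowerSeries.derivative ℂ f := by
    intro c f
    rw [Derivation.leibniz, PowerSeries.derivative_C, smul_zero, add_zero, smul_eq_mul]
  have h1 : ∀ k ∈ Finset.range (n + 1), PowerSeries.coeff n (PowerSeries.derivative ℂ
      (PowerSeries.C (w (k + 1)) * (PowerSeries.X * Ψ) ^ (k + 1)) * Φ ^ (n + 1)) =
      if k = n then ((n : ℂ) + 1) * w (n + 1) else 0 := by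
    intro k hk
    rw [hC, mul_assoc, PowerSeries.coeff_C_mul,
      coeff_derivative_pow_mul_pow hΦ (Nat.lt_succ_iff.mp (Finset.mem_range.mp hk))]
    split_ifs with h
    · rw [h, mul_comm]
    · rw [mul_zero]
  rw [Finset.sum_congr rfl h1, Finset.sum_ite_eq' , if_pos (Finset.self_mem_range_succ n)]
  have h2 : PowerSeries.derivative ℂ ((PowerSeries.X * Ψ) ^ (n + 2) * ρ) * Φ ^ (n + 1) =
      PowerSeries.X ^ (n + 1) * ((Ψ ^ (n + 1) * (PowerSeries.X * Ψ * PowerSeries.derivative ℂ ρ +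
        ρ * ((n + 2 : ℕ) : PowerSeries ℂ) * PowerSeries.derivative ℂ (PowerSeries.X * Ψ))) *
          Φ ^ (n + 1)) := by
    rw [Derivation.leibniz, PowerSeries.derivative_pow, smul_eq_mul, smul_eq_mul]
    simp only [show n + 2 - 1 = n + 1 from rfl]
    ring
  rw [h2, coeff_X_pow_mul_eq_zero (Nat.lt_succ_self n), pow_zero, mul_one, PowerSeries.derivative_C,
    zero_mul, map_zero, add_zero, add_zero]

/-! ### Taylor series of analytic functions -/

/-- The Taylor series at the origin. -/
def taylor (f : ℂ → ℂ) : PowerSeries ℂ :=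
  PowerSeries.mk fun n => iteratedDeriv n f 0 / (n.factorial : ℂ)

theorem taylor_congr {f g : ℂ → ℂ} (h : f =ᶠ[𝓝 0] g) : taylor f = taylor g := by
  ext n
  rw [taylor, taylor, PowerSeries.coeff_mk, PowerSeries.coeff_mk, h.iteratedDeriv_eq]

theorem constantCoeff_taylor (f : ℂ → ℂ) : PowerSeries.constantCoeff (taylor f) = f 0 := by
  rw [← PowerSeries.coeff_zero_eq_constantCoeff_apply, taylor, PowerSeries.coeff_mk]
  simp

theorem taylor_deriv (f : ℂ → ℂ) : taylor (deriv f) = PowerSeries.derivative ℂ (taylor f) := by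
  ext n
  have hn : (n : ℂ) + 1 ≠ 0 := Nat.cast_add_one_ne_zero n
  rw [PowerSeries.coeff_derivative, taylor, taylor, PowerSeries.coeff_mk, PowerSeries.coeff_mk,
    iteratedDeriv_succ', Nat.factorial_succ]
  push_cast
  field_simp

theorem taylor_const (c : ℂ) : taylor (fun _ => c) = PowerSeries.C c := by
  refine PowerSeries.derivative.ext ?_ ?_
  · rw [← taylor_deriv, PowerSeries.derivative_C]
    ext n
    rw [taylor, PowerSeries.coeff_mk, deriv_const']
    simp
  · rw [constantCoeff_taylor, PowerSeries.constantCoeff_C]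

theorem taylor_id : taylor (fun t => t) = PowerSeries.X := by
  refine PowerSeries.derivative.ext ?_ ?_
  · rw [← taylor_deriv, PowerSeries.derivative_X, deriv_id'', taylor_const, map_one]
  · rw [constantCoeff_taylor, PowerSeries.constantCoeff_X]

theorem analyticAt_fun_id : AnalyticAt ℂ (fun t : ℂ => t) 0 := analyticAt_id

theorem taylor_add {f g : ℂ → ℂ} (hf : AnalyticAt ℂ f 0) (hg : AnalyticAt ℂ g 0) :
    taylor (fun t => f t + g t) = taylor f + taylor g := by
  ext n
  rw [map_add, taylor, taylor, taylor, PowerSeries.coeff_mk, PowerSeries.coeff_mk,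
    PowerSeries.coeff_mk, iteratedDeriv_fun_add hf.contDiffAt hg.contDiffAt, add_div]

theorem taylor_mul {f g : ℂ → ℂ} (hf : AnalyticAt ℂ f 0) (hg : AnalyticAt ℂ g 0) :
    taylor (fun t => f t * g t) = taylor f * taylor g := by
  ext n
  rw [PowerSeries.coeff_mul, Finset.Nat.sum_antidiagonal_eq_sum_range_succ_mk, taylor, taylor, taylor,
    PowerSeries.coeff_mk]
  change iteratedDeriv n (f * g) 0 / _ = _
  rw [iteratedDeriv_mul hf.contDiffAt hg.contDiffAt, Finset.sum_div]
  refine Finset.sum_congr rfl fun i hi => ?_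
  rw [PowerSeries.coeff_mk, PowerSeries.coeff_mk,
    Nat.cast_choose ℂ (Nat.lt_succ_iff.mp (Finset.mem_range.mp hi))]
  have hf : (n.factorial : ℂ) ≠ 0 := Nat.cast_ne_zero.mpr (Nat.factorial_ne_zero _)
  field_simp

theorem taylor_pow {f : ℂ → ℂ} (hf : AnalyticAt ℂ f 0) (n : ℕ) :
    taylor (fun t => f t ^ n) = taylor f ^ n := by
  induction n with
  | zero => simp only [pow_zero]; rw [taylor_const, map_one]
  | succ n ih => simp only [pow_succ]; rw [taylor_mul (hf.fun_pow n) hf, ih]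

theorem taylor_sum {ι : Type*} (s : Finset ι) {f : ι → ℂ → ℂ} (hf : ∀ i ∈ s, AnalyticAt ℂ (f i) 0) :
    taylor (fun t => ∑ i ∈ s, f i t) = ∑ i ∈ s, taylor (f i) := by
  classical
  induction s using Finset.induction_on with
  | empty => simp only [Finset.sum_empty]; rw [taylor_const, map_zero]
  | insert a s ha ih =>
    simp only [Finset.sum_insert ha]
    rw [taylor_add (hf a (Finset.mem_insert_self a s))
      (Finset.analyticAt_fun_sum _ fun i hi => hf i (Finset.mem_insert_of_mem hi)),
      ih fun i hi => hf i (Finset.mem_insert_of_mem hi)]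

theorem hasSum_coeff_taylor {f : ℂ → ℂ} {r : ℝ} (hf : DifferentiableOn ℂ f (Metric.ball 0 r))
    {z : ℂ} (hz : z ∈ Metric.ball (0 : ℂ) r) :
    HasSum (fun n => PowerSeries.coeff n (taylor f) * z ^ n) (f z) := by
  convert! Complex.hasSum_taylorSeries_on_ball hf hz using 2 with n
  rw [taylor, PowerSeries.coeff_mk, sub_zero, smul_eq_mul, smul_eq_mul]
  ring

/-! ### The germ of the spectral curve at infinity -/

/-- The germ of `log ((1 - v t) / (1 - u t))` at the origin. -/
def logQuot (u v t : ℂ) : ℂ := Complex.log (1 - v * t) - Complex.log (1 - u * t)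

theorem analyticAt_logQuot (u v : ℂ) : AnalyticAt ℂ (logQuot u v) 0 := by
  have h : ∀ r : ℂ, AnalyticAt ℂ (fun t : ℂ => Complex.log (1 - r * t)) 0 := by
    intro r
    refine AnalyticAt.clog (by fun_prop) ?_
    rw [mul_zero, sub_zero]
    exact Complex.one_mem_slitPlane
  exact (h v).sub (h u)

theorem logQuot_zero (u v : ℂ) : logQuot u v 0 = 0 := by
  simp [logQuot]

theorem eventually_one_sub_mem_slitPlane (r : ℂ) :
    ∀ᶠ t in 𝓝 (0 : ℂ), 1 - r * t ∈ Complex.slitPlane := by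
  have hc : ContinuousAt (fun t : ℂ => 1 - r * t) 0 := by fun_prop
  refine hc.eventually_mem (Complex.isOpen_slitPlane.mem_nhds ?_)
  rw [mul_zero, sub_zero]
  exact Complex.one_mem_slitPlane

theorem eventually_deriv_logQuot (u v : ℂ) : ∀ᶠ t in 𝓝 (0 : ℂ),
    (1 - u * t) * (1 - v * t) * deriv (logQuot u v) t = u - v := by
  filter_upwards [eventually_one_sub_mem_slitPlane u, eventually_one_sub_mem_slitPlane v]
    with t hu hv
  have hd : ∀ r : ℂ, 1 - r * t ∈ Complex.slitPlane →
      HasDerivAt (fun t : ℂ => Complex.log (1 - r * t)) (-r / (1 - r * t)) t := by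
    intro r hr
    refine HasDerivAt.clog ?_ hr
    simpa using ((hasDerivAt_id t).const_mul r).const_sub 1
  have hd2 : HasDerivAt (logQuot u v) _ t := (hd v hv).sub (hd u hu)
  rw [hd2.deriv]
  have h1 := mul_inv_cancel₀ (Complex.slitPlane_ne_zero hu)
  have h2 := mul_inv_cancel₀ (Complex.slitPlane_ne_zero hv)
  rw [div_eq_mul_inv, div_eq_mul_inv]
  linear_combination u * (1 - v * t) * h1 - v * (1 - u * t) * h2

theorem taylor_logQuot (u v : ℂ) : taylor (logQuot u v) = logQuotSeries u v := by
  have hlin : ∀ r : ℂ, AnalyticAt ℂ (fun t : ℂ => 1 - r * t) 0 := fun r => by fun_prop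
  have htl : ∀ r : ℂ, taylor (fun t : ℂ => 1 - r * t) = 1 - PowerSeries.C r * PowerSeries.X := by
    intro r
    have e : (fun t : ℂ => 1 - r * t) = fun t => (fun _ => (1 : ℂ)) t + (fun t => (-r) * t) t := by
      funext t; ring
    rw [e, taylor_add analyticAt_const (by fun_prop), taylor_const,
      taylor_mul analyticAt_const analyticAt_fun_id, taylor_const, taylor_id, map_neg, map_one]
    ring
  refine PowerSeries.derivative.ext ?_ ?_
  · have h1 := taylor_congr (eventually_deriv_logQuot u v)
    rw [taylor_mul ((hlin u).fun_mul (hlin v)) (analyticAt_logQuot u v).deriv,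
      taylor_mul (hlin u) (hlin v), htl, htl, taylor_const, taylor_deriv,
      ← derivative_logQuotSeries] at h1
    refine mul_left_cancel₀ ?_ h1
    refine mul_ne_zero ?_ ?_ <;>
    · intro h
      have := congrArg PowerSeries.constantCoeff h
      simp at this
  · rw [constantCoeff_taylor, constantCoeff_logQuotSeries, logQuot_zero]

/-- The analytic and the formal exponential satisfy the same linear equation and both start with
`1`; no composition theorem for Taylor series is involved. -/
theorem taylor_exp_mul_logQuot (c u v : ℂ) :
    taylor (fun t => Complex.exp (c * logQuot u v t)) =
      (PowerSeries.exp ℂ).subst (c • logQuotSeries u v) := by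
  have hL := analyticAt_logQuot u v
  have hcL : AnalyticAt ℂ (fun t => c * logQuot u v t) 0 := analyticAt_const.mul hL
  refine eq_of_derivative_eq_mul ?_
    (derivative_exp_subst (hasSubst_smul_logQuotSeries c u v)) ?_
  · have hd : deriv (fun t => Complex.exp (c * logQuot u v t)) =ᶠ[𝓝 0]
        fun t => (c * deriv (logQuot u v) t) * Complex.exp (c * logQuot u v t) := by
      filter_upwards [hL.eventually_analyticAt] with t ht
      have := ((ht.differentiableAt.hasDerivAt.const_mul c).cexp).deriv
      rw [this]
      ring
    rw [← taylor_deriv, taylor_congr hd, taylor_mul (analyticAt_const.fun_mul hL.deriv) hcL.cexp',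
      taylor_mul analyticAt_const hL.deriv, taylor_const, taylor_deriv, taylor_logQuot,
      PowerSeries.smul_eq_C_mul, Derivation.leibniz, PowerSeries.derivative_C, smul_zero, add_zero,
      smul_eq_mul]
  · rw [constantCoeff_taylor, logQuot_zero, mul_zero, Complex.exp_zero, constantCoeff_exp_subst]
    rw [PowerSeries.smul_eq_C_mul, map_mul, constantCoeff_logQuotSeries, mul_zero]

/-- The function `1 / Λ` in the coordinate `t`. -/
def invLam (b u v t : ℂ) : ℂ := t * Complex.exp (-b * logQuot u v t)

theorem analyticAt_invLam (b u v : ℂ) : AnalyticAt ℂ (invLam b u v) 0 :=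
  analyticAt_id.mul (analyticAt_const.mul (analyticAt_logQuot u v)).cexp'

theorem invLam_zero (b u v : ℂ) : invLam b u v 0 = 0 := zero_mul _

theorem deriv_invLam_zero (b u v : ℂ) : deriv (invLam b u v) 0 = 1 := by
  have hE : AnalyticAt ℂ (fun t => Complex.exp (-b * logQuot u v t)) 0 :=
    (analyticAt_const.mul (analyticAt_logQuot u v)).cexp'
  have := ((hasDerivAt_id (0 : ℂ)).mul hE.differentiableAt.hasDerivAt).deriv
  have h2 : deriv (invLam b u v) 0 = _ := this
  rw [h2, logQuot_zero]
  simp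

/-- Lagrange inversion for `X = t e^{-bL}`: `m [X^m] W = [t^{m-1}] L' e^{bmL}`. The right side is
the derivative of `e^{bmL}` divided by `bm`, so it equals `m [t^m] e^{bmL}/(bm)`. -/
theorem coeff_taylor_of_comp_invLam {b : ℂ} (hb : b ≠ 0) {u v : ℂ} {W : ℂ → ℂ}
    (hW : AnalyticAt ℂ W 0) (hcomp : ∀ᶠ t in 𝓝 (0 : ℂ), W (invLam b u v t) = logQuot u v t)
    (n : ℕ) : PowerSeries.coeff (n + 1) (taylor W) =
      PowerSeries.coeff (n + 1) ((PowerSeries.exp ℂ).subst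
        ((b * ((n + 1 : ℕ) : ℂ)) • logQuotSeries u v)) / (b * ((n + 1 : ℕ) : ℂ)) := by
  set L := logQuot u v with hLdef
  have hL : AnalyticAt ℂ L 0 := analyticAt_logQuot u v
  have hE : ∀ c : ℂ, AnalyticAt ℂ (fun t => Complex.exp (c * L t)) 0 := fun c =>
    (analyticAt_const.mul hL).cexp'
  have hh : AnalyticAt ℂ (invLam b u v) 0 := analyticAt_invLam b u v
  set Φ := taylor (fun t => Complex.exp (b * L t)) with hΦ
  set Ψ := taylor (fun t => Complex.exp (-b * L t)) with hΨ
  have hΦΨ : Φ * Ψ = 1 := by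
    rw [hΦ, hΨ, ← taylor_mul (hE b) (hE (-b)), ← map_one PowerSeries.C, ← taylor_const]
    congr 1
    funext t
    rw [← Complex.exp_add]
    simp
  have hH : taylor (invLam b u v) = PowerSeries.X * Ψ := by
    rw [hΨ, ← taylor_id, ← taylor_mul analyticAt_fun_id (hE (-b))]
    rfl
  -- Order `n + 2` is the first whose remainder does not affect the coefficient extracted in
  -- `lagrange_coeff`.
  obtain ⟨F, hF, hWF⟩ := hW.exists_eq_sum_add_pow_mul (n + 2)
  have hF' : AnalyticAt ℂ (fun t => F (invLam b u v t)) 0 := by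
    refine AnalyticAt.fun_comp ?_ hh
    rw [invLam_zero]
    exact hF
  have hpart : ∀ k : ℕ, AnalyticAt ℂ
      (fun t => PowerSeries.coeff k (taylor W) * invLam b u v t ^ k) 0 := fun k =>
    analyticAt_const.mul (hh.fun_pow k)
  have hexp : L =ᶠ[𝓝 0] fun t =>
      (fun t => ∑ k ∈ Finset.range (n + 2), PowerSeries.coeff k (taylor W) * invLam b u v t ^ k) t +
        (fun t => invLam b u v t ^ (n + 2) * F (invLam b u v t)) t := by
    filter_upwards [hcomp] with t ht
    rw [← ht, hWF, smul_eq_mul]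
    congr 1
    refine Finset.sum_congr rfl fun k _ => ?_
    rw [taylor, PowerSeries.coeff_mk, smul_eq_mul]
    ring
  have hser := taylor_congr hexp
  rw [taylor_add (Finset.analyticAt_fun_sum _ fun k _ => hpart k) ((hh.fun_pow _).fun_mul hF'),
    taylor_sum _ fun k _ => hpart k, taylor_mul (hh.fun_pow _) hF', taylor_pow hh, hH] at hser
  have hterm : ∀ k ∈ Finset.range (n + 2),
      taylor (fun t => PowerSeries.coeff k (taylor W) * invLam b u v t ^ k) =
        PowerSeries.C (PowerSeries.coeff k (taylor W)) * (PowerSeries.X * Ψ) ^ k := by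
    intro k _
    rw [taylor_mul analyticAt_const (hh.fun_pow k), taylor_const, taylor_pow hh, hH]
  rw [Finset.sum_congr rfl hterm] at hser
  have key := lagrange_coeff hΦΨ n (fun k => PowerSeries.coeff k (taylor W)) hser
  have hΦpow : Φ ^ (n + 1) = (PowerSeries.exp ℂ).subst
      ((b * ((n + 1 : ℕ) : ℂ)) • logQuotSeries u v) := by
    rw [← taylor_exp_mul_logQuot, hΦ, ← taylor_pow (hE b)]
    congr 1
    funext t
    rw [← Complex.exp_nat_mul, hLdef]
    congr 1
    ring
  have hc : b * ((n + 1 : ℕ) : ℂ) ≠ 0 := mul_ne_zero hb (Nat.cast_ne_zero.mpr (Nat.succ_ne_zero n))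
  have hn : (n : ℂ) + 1 ≠ 0 := Nat.cast_add_one_ne_zero n
  have hder := derivative_exp_subst (hasSubst_smul_logQuotSeries (b * ((n + 1 : ℕ) : ℂ)) u v)
  have hder' := congrArg (PowerSeries.coeff n) hder
  rw [PowerSeries.coeff_derivative, PowerSeries.smul_eq_C_mul, Derivation.leibniz,
    PowerSeries.derivative_C, smul_zero, add_zero, smul_eq_mul, ← PowerSeries.smul_eq_C_mul,
    ← PowerSeries.smul_eq_C_mul, smul_mul_assoc, PowerSeries.coeff_smul, ← hΦpow, ← taylor_logQuot,
    key, smul_eq_mul] at hder'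
  rw [eq_div_iff hc, ← hΦpow]
  refine mul_right_cancel₀ hn ?_
  rw [hder']
  ring

/-- The one-point series in the coordinate `1 / Λ`, up to the factor `Q`. -/
theorem exists_onePointSeries {b : ℂ} (hb : b ≠ 0) (u v : ℂ) : ∃ f : ℂ → ℂ,
    (∀ᶠ X in 𝓝 (0 : ℂ), DifferentiableAt ℂ f X ∧ HasSum (fun n : ℕ =>
      PowerSeries.coeff (n + 1) ((PowerSeries.exp ℂ).subst
        ((b * ((n + 1 : ℕ) : ℂ)) • logQuotSeries u v)) /
          (b * ((n + 1 : ℕ) : ℂ)) / ((n + 1 : ℕ) : ℂ) * X ^ (n + 1)) (f X)) ∧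
    ∀ᶠ t in 𝓝 (0 : ℂ), invLam b u v t * deriv f (invLam b u v t) = logQuot u v t := by
  have hh := analyticAt_invLam b u v
  have hd : deriv (invLam b u v) 0 ≠ 0 := by rw [deriv_invLam_zero]; exact one_ne_zero
  obtain ⟨τ, hτ, hτ0, hτh⟩ : ∃ τ : ℂ → ℂ, AnalyticAt ℂ τ 0 ∧ τ 0 = 0 ∧
      ∀ᶠ t in 𝓝 (0 : ℂ), τ (invLam b u v t) = t := by
    refine ⟨hh.hasStrictDerivAt.localInverse _ _ _ hd, ?_, ?_,
      hh.hasStrictDerivAt.eventually_left_inverse hd⟩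
    · have := hh.analyticAt_localInverse hd
      rwa [invLam_zero] at this
    · have := (hh.hasStrictDerivAt.eventually_left_inverse hd).self_of_nhds
      rwa [invLam_zero] at this
  set W : ℂ → ℂ := fun X => logQuot u v (τ X) with hWdef
  have hW : AnalyticAt ℂ W 0 := by
    refine AnalyticAt.fun_comp ?_ hτ
    rw [hτ0]
    exact analyticAt_logQuot u v
  have hcomp : ∀ᶠ t in 𝓝 (0 : ℂ), W (invLam b u v t) = logQuot u v t := by
    filter_upwards [hτh] with t ht
    rw [hWdef]
    simp only
    rw [ht]
  have hW0 : W 0 = 0 := by rw [hWdef]; simp only; rw [hτ0, logQuot_zero]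
  obtain ⟨r, hr, hball⟩ := Metric.eventually_nhds_iff_ball.mp hW.eventually_analyticAt
  have hWd : DifferentiableOn ℂ W (Metric.ball 0 r) := fun z hz =>
    (hball z hz).differentiableAt.differentiableWithinAt
  -- Since `W 0 = 0`, this slope is `W(X)/X` extended to the origin. Its primitive `f` satisfies `X
  -- f' = W`, which divides each Taylor coefficient of `W` by its degree.
  have hG : DifferentiableOn ℂ (dslope W 0) (Metric.ball 0 r) :=
    (Complex.differentiableOn_dslope (Metric.ball_mem_nhds 0 hr)).mpr hWd
  obtain ⟨f, hf0, hf⟩ := hG.isExactOn_ball.with_val_at 0 0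
  have hfd : DifferentiableOn ℂ f (Metric.ball 0 r) := fun z hz =>
    (hf z hz).differentiableAt.differentiableWithinAt
  have hXf : ∀ X ∈ Metric.ball (0 : ℂ) r, X * deriv f X = W X := by
    intro X hX
    rw [(hf X hX).deriv]
    have := sub_smul_dslope W 0 X
    rwa [sub_zero, hW0, sub_zero, smul_eq_mul] at this
  have hfan : AnalyticAt ℂ f 0 := hfd.analyticAt (Metric.ball_mem_nhds 0 hr)
  have hWser : taylor W = PowerSeries.X * PowerSeries.derivative ℂ (taylor f) := by
    rw [← taylor_deriv, ← taylor_id, ← taylor_mul analyticAt_fun_id hfan.deriv]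
    refine taylor_congr ?_
    filter_upwards [Metric.ball_mem_nhds 0 hr] with X hX
    exact (hXf X hX).symm
  have hcoef : ∀ n : ℕ, PowerSeries.coeff (n + 1) (taylor f) =
      PowerSeries.coeff (n + 1) ((PowerSeries.exp ℂ).subst
        ((b * ((n + 1 : ℕ) : ℂ)) • logQuotSeries u v)) /
          (b * ((n + 1 : ℕ) : ℂ)) / ((n + 1 : ℕ) : ℂ) := by
    intro n
    rw [← coeff_taylor_of_comp_invLam hb hW hcomp n, hWser, PowerSeries.coeff_succ_X_mul,
      PowerSeries.coeff_derivative]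
    have hn : (n : ℂ) + 1 ≠ 0 := Nat.cast_add_one_ne_zero n
    push_cast
    field_simp
  refine ⟨f, ?_, ?_⟩
  · filter_upwards [Metric.ball_mem_nhds 0 hr] with X hX
    refine ⟨(hf X hX).differentiableAt, ?_⟩
    have hs := hasSum_coeff_taylor hfd hX
    -- The normalization `f 0 = 0` lets the sum start in degree one.
    rw [← hasSum_nat_add_iff' 1] at hs
    simp only [Finset.sum_range_one, PowerSeries.coeff_zero_eq_constantCoeff_apply,
      constantCoeff_taylor, hf0, zero_mul, sub_zero, hcoef] at hs
    exact hs
  · have hcont : Tendsto (invLam b u v) (𝓝 0) (𝓝 0) := by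
      have := hh.continuousAt.tendsto
      rwa [invLam_zero] at this
    filter_upwards [hcont.eventually (Metric.ball_mem_nhds 0 hr), hcomp] with t ht hct
    rw [hXf _ ht, hct]

/-! ### The spectral curve near infinity -/

/-- The periods `2πi ℤ` are discrete: two logarithms of the same function whose difference tends to
`0` eventually coincide. -/
theorem eventually_eq_zero_of_exp_eq_one :
    ∀ᶠ z in 𝓝 (0 : ℂ), Complex.exp z = 1 → z = 0 := by
  have hc : ContinuousAt (fun z : ℂ => z.im) 0 := Complex.continuous_im.continuousAt
  have hI : Set.Ioo (-Real.pi) Real.pi ∈ 𝓝 ((0 : ℂ).im) := by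
    rw [Complex.zero_im]
    exact Ioo_mem_nhds (neg_lt_zero.mpr Real.pi_pos) Real.pi_pos
  filter_upwards [hc.eventually_mem hI] with z hz h
  rw [← Complex.log_exp hz.1 hz.2.le, h, Complex.log_one]

/-- Near `U` the quotient `f z / f U` is close to `1`, where the principal logarithm is holomorphic;
by continuity `L` differs from it only by the constant `L U`. -/
theorem IsLogOn.differentiableAt {Ω : Set ℂ} (hΩ : IsOpen Ω) {f L : ℂ → ℂ} (h : IsLogOn Ω f L)
    {U : ℂ} (hU : U ∈ Ω) (hf : DifferentiableAt ℂ f U) : DifferentiableAt ℂ L U := by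
  have hfU : f U ≠ 0 := by rw [← h.2 U hU]; exact Complex.exp_ne_zero _
  have hq : DifferentiableAt ℂ (fun z => Complex.log (f z / f U)) U := by
    refine (hf.div_const _).clog ?_
    rw [div_self hfU]
    exact Complex.one_mem_slitPlane
  have hL : ContinuousAt L U := h.1.continuousAt (hΩ.mem_nhds hU)
  have hlim : Tendsto (fun z => L z - L U - Complex.log (f z / f U)) (𝓝 U) (𝓝 0) := by
    have h1 : ContinuousAt (fun z => L z - L U - Complex.log (f z / f U)) U :=
      (hL.sub continuousAt_const).sub hq.continuousAt
    have h2 := h1.tendsto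
    rwa [div_self hfU, Complex.log_one, sub_self, sub_zero] at h2
  have heq : L =ᶠ[𝓝 U] fun z => L U + Complex.log (f z / f U) := by
    filter_upwards [hlim.eventually eventually_eq_zero_of_exp_eq_one, hΩ.mem_nhds hU] with z hz hzΩ
    have hfz : f z ≠ 0 := by rw [← h.2 z hzΩ]; exact Complex.exp_ne_zero _
    have := hz (by
      rw [Complex.exp_sub, Complex.exp_sub, h.2 z hzΩ, h.2 U hU,
        Complex.exp_log (div_ne_zero hfz hfU), div_self (div_ne_zero hfz hfU)])
    linear_combination this
  exact (hq.const_add _).congr_of_eventuallyEq heq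

/-- Identities valid near infinity in the open set `Ω` hold in a neighbourhood of each such point,
so they may be differentiated. -/
theorem eventually_eventually_nhds_of_cobounded {Ω : Set ℂ} (hΩ : IsOpen Ω) {p : ℂ → Prop}
    (h : ∀ᶠ U in cobounded ℂ ⊓ 𝓟 Ω, p U) :
    ∀ᶠ U in cobounded ℂ ⊓ 𝓟 Ω, ∀ᶠ z in 𝓝 U, p z := by
  rw [eventually_inf_principal] at h ⊢
  obtain ⟨R, -, hR⟩ := (Filter.hasBasis_cobounded_norm (E := ℂ)).eventually_iff.mp h
  filter_upwards [(Filter.hasBasis_cobounded_norm (E := ℂ)).mem_of_mem (i := R + 1) trivial]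
    with U hU hUΩ
  have h1 : ∀ᶠ z in 𝓝 U, R < ‖z‖ := by
    refine continuous_norm.continuousAt.eventually_const_lt ?_
    have : R + 1 ≤ ‖U‖ := hU
    linarith
  filter_upwards [h1, hΩ.mem_nhds hUΩ] with z hz hzΩ
  exact hR hz.le hzΩ

section Branch

variable {P : ℤ} {Q : ℕ} {ℓ : ℂ} {Ω : Set ℂ} {L₀ Lp Lm : ℂ → ℂ}

theorem IsBranch.differentiableAt_log (h : IsBranch P Q ℓ Ω L₀ Lp Lm) {U : ℂ} (hU : U ∈ Ω) :
    DifferentiableAt ℂ L₀ U ∧ DifferentiableAt ℂ Lp U ∧ DifferentiableAt ℂ Lm U :=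
  ⟨h.log_U.differentiableAt h.isOpen hU (by fun_prop),
    h.log_plus.differentiableAt h.isOpen hU (by fun_prop),
    h.log_minus.differentiableAt h.isOpen hU (by fun_prop)⟩

theorem IsBranch.differentiableAt_curveLam (h : IsBranch P Q ℓ Ω L₀ Lp Lm) {U : ℂ} (hU : U ∈ Ω) :
    DifferentiableAt ℂ (curveLam P Q L₀ Lp Lm) U := by
  obtain ⟨h0, h1, h2⟩ := h.differentiableAt_log hU
  exact (((h0.const_mul (Q : ℂ)).add (h1.const_mul (P : ℂ))).sub (h2.const_mul (P : ℂ))).div_const _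

theorem IsBranch.ne_zero (h : IsBranch P Q ℓ Ω L₀ Lp Lm) {U : ℂ} (hU : U ∈ Ω) : U ≠ 0 := by
  have hexp : Complex.exp (L₀ U) = U := h.log_U.2 U hU
  rw [← hexp]
  exact Complex.exp_ne_zero _

/-- The coordinate `t = A^(-2b) / U` at infinity. -/
def coordAtInfinity (P : ℤ) (Q : ℕ) (ℓ U : ℂ) : ℂ := U⁻¹ * powA ℓ (-(2 * slope P Q))

theorem tendsto_coordAtInfinity (P : ℤ) (Q : ℕ) (ℓ : ℂ) (Ω : Set ℂ) :
    Tendsto (coordAtInfinity P Q ℓ) (cobounded ℂ ⊓ 𝓟 Ω) (𝓝 0) := by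
  have h : Tendsto (fun U : ℂ => U⁻¹ * powA ℓ (-(2 * slope P Q))) (cobounded ℂ)
      (𝓝 (0 * powA ℓ (-(2 * slope P Q)))) := Filter.tendsto_inv₀_cobounded.mul_const _
  rw [zero_mul] at h
  exact h.mono_left inf_le_left

/-- As `u v = A^{2b}`, one has `1/(uU) = v t` and `1/(vU) = u t`, so `1 - uU = -uU (1 - v t)` and `1
- vU = -vU (1 - u t)`. The two sides then agree up to a multiple of `2πi`, and the prescribed limit
`2ℓ` forces that multiple to vanish. -/
theorem IsBranch.eventually_sub_eq (h : IsBranch P Q ℓ Ω L₀ Lp Lm) :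
    ∀ᶠ U in cobounded ℂ ⊓ 𝓟 Ω, Lp U - Lm U - 2 * ℓ =
      logQuot (powA ℓ (slope P Q + 1)) (powA ℓ (slope P Q - 1)) (coordAtInfinity P Q ℓ U) := by
  set u := powA ℓ (slope P Q + 1) with hu
  set v := powA ℓ (slope P Q - 1) with hv
  have ht := tendsto_coordAtInfinity P Q ℓ Ω
  have hlim : Tendsto (fun U => Lp U - Lm U - 2 * ℓ - logQuot u v (coordAtInfinity P Q ℓ U))
      (cobounded ℂ ⊓ 𝓟 Ω) (𝓝 0) := by
    have h1 := (h.tendsto.sub_const (2 * ℓ)).sub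
      ((analyticAt_logQuot u v).continuousAt.tendsto.comp ht)
    rw [logQuot_zero, sub_self, sub_zero] at h1
    exact h1
  filter_upwards [hlim.eventually eventually_eq_zero_of_exp_eq_one,
    ht.eventually (eventually_one_sub_mem_slitPlane u),
    ht.eventually (eventually_one_sub_mem_slitPlane v), mem_inf_of_right (mem_principal_self Ω)]
    with U hU hsu hsv hUΩ
  refine sub_eq_zero.mp (hU ?_)
  have hU0 := h.ne_zero hUΩ
  have huv : u * v * powA ℓ (-(2 * slope P Q)) = 1 := by
    rw [hu, hv, ← powA_add, ← powA_add, powA]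
    ring_nf
    exact Complex.exp_zero
  have e1 : Complex.exp (Lp U) = -u * U * (1 - v * coordAtInfinity P Q ℓ U) := by
    rw [h.log_plus.2 U hUΩ, ← hu]
    rw [coordAtInfinity]
    field_simp
    linear_combination -huv
  have e2 : Complex.exp (Lm U) = -v * U * (1 - u * coordAtInfinity P Q ℓ U) := by
    rw [h.log_minus.2 U hUΩ, ← hv]
    rw [coordAtInfinity]
    field_simp
    linear_combination -huv
  have e3 : u = v * Complex.exp (2 * ℓ) := by
    rw [hu, hv, ← powA, ← powA_add]
    ring_nf
  have hu0 : 1 - u * coordAtInfinity P Q ℓ U ≠ 0 := Complex.slitPlane_ne_zero hsu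
  have hv0 : 1 - v * coordAtInfinity P Q ℓ U ≠ 0 := Complex.slitPlane_ne_zero hsv
  have hvne : v ≠ 0 := Complex.exp_ne_zero _
  rw [Complex.exp_sub, Complex.exp_sub, Complex.exp_sub, e1, e2, logQuot, Complex.exp_sub,
    Complex.exp_log hu0, Complex.exp_log hv0]
  have h2 := Complex.exp_ne_zero (2 * ℓ)
  rw [div_eq_one_iff_eq (div_ne_zero hv0 hu0), div_div, div_eq_div_iff
    (mul_ne_zero (mul_ne_zero (mul_ne_zero (neg_ne_zero.mpr hvne) hU0) hu0) h2) hu0]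
  linear_combination (-U * (1 - v * coordAtInfinity P Q ℓ U) *
    (1 - u * coordAtInfinity P Q ℓ U)) * e3

theorem curveLam_eq (hQ : 0 < Q) (U : ℂ) :
    curveLam P Q L₀ Lp Lm U = L₀ U + slope P Q * (Lp U - Lm U) := by
  have hQ0 : (Q : ℂ) ≠ 0 := Nat.cast_ne_zero.mpr hQ.ne'
  rw [curveLam, curveX, slope]
  field_simp
  ring

/-- The constant `2ℓ` in `Lp - Lm` contributes `A^{-2b}` to `1/Λ`, which is exactly the
normalization of `t`. -/
theorem IsBranch.eventually_exp_neg_curveLam (h : IsBranch P Q ℓ Ω L₀ Lp Lm) (hQ : 0 < Q) :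
    ∀ᶠ U in cobounded ℂ ⊓ 𝓟 Ω, Complex.exp (-curveLam P Q L₀ Lp Lm U) =
      invLam (slope P Q) (powA ℓ (slope P Q + 1)) (powA ℓ (slope P Q - 1))
        (coordAtInfinity P Q ℓ U) := by
  filter_upwards [h.eventually_sub_eq, mem_inf_of_right (mem_principal_self Ω)] with U hU hUΩ
  rw [invLam, ← hU, coordAtInfinity, curveLam_eq hQ, neg_add, Complex.exp_add, Complex.exp_neg,
    h.log_U.2 U hUΩ, mul_assoc, powA, ← Complex.exp_add]
  congr 2
  ring

/-- `1/Λ` is a local coordinate at infinity: `invLam` has derivative `1` at the origin, and `t` has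
nonzero derivative in `U`. -/
theorem IsBranch.eventually_deriv_curveLam_ne_zero (h : IsBranch P Q ℓ Ω L₀ Lp Lm) (hQ : 0 < Q) :
    ∀ᶠ U in cobounded ℂ ⊓ 𝓟 Ω, deriv (curveLam P Q L₀ Lp Lm) U ≠ 0 := by
  set u := powA ℓ (slope P Q + 1) with hu
  set v := powA ℓ (slope P Q - 1) with hv
  have hh := analyticAt_invLam (slope P Q) u v
  have hd : ∀ᶠ t in 𝓝 (0 : ℂ), deriv (invLam (slope P Q) u v) t ≠ 0 := by
    refine hh.deriv.continuousAt.eventually_ne ?_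
    rw [deriv_invLam_zero]
    exact one_ne_zero
  have ht := tendsto_coordAtInfinity P Q ℓ Ω
  filter_upwards [eventually_eventually_nhds_of_cobounded h.isOpen
    (h.eventually_exp_neg_curveLam hQ), ht.eventually hd,
    ht.eventually hh.eventually_analyticAt, mem_inf_of_right (mem_principal_self Ω)]
    with U hU hdt hat hUΩ hzero
  have hlam := (h.differentiableAt_curveLam hUΩ).hasDerivAt
  rw [hzero] at hlam
  have h1 := hlam.neg.cexp
  have ht' : HasDerivAt (coordAtInfinity P Q ℓ) (-(U ^ 2)⁻¹ * powA ℓ (-(2 * slope P Q))) U :=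
    (hasDerivAt_inv (h.ne_zero hUΩ)).mul_const _
  have h2 := hat.differentiableAt.hasDerivAt.comp U ht'
  have h3 := h1.unique (h2.congr_of_eventuallyEq hU)
  rw [neg_zero, mul_zero] at h3
  refine mul_ne_zero hdt (mul_ne_zero (neg_ne_zero.mpr (inv_ne_zero (pow_ne_zero 2 (h.ne_zero hUΩ))))
    (Complex.exp_ne_zero _)) h3.symm

theorem curveY_sub (γ : ℤ) (U : ℂ) :
    curveY P Q γ L₀ Lp Lm U - (γ : ℂ) / (Q : ℂ) * curveX P Q L₀ Lp Lm U =
      1 / (Q : ℂ) * (Lp U - Lm U) := by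
  rw [curveY]
  ring

/-- Near infinity `F01 = Q f(X)` with `X = e^{-λ}`, and the chain rule gives `-Q λ' · X f'(X)`,
where `X f'(X) = L(t) = Lp - Lm - 2ℓ`. -/
theorem IsBranch.eventually_F01 (h : IsBranch P Q ℓ Ω L₀ Lp Lm) (hP : P ≠ 0) (hQ : 0 < Q) :
    ∀ᶠ U in cobounded ℂ ⊓ 𝓟 Ω, Summable (termF01 P Q ℓ L₀ Lp Lm U) ∧
      HasDerivAt (F01 P Q ℓ L₀ Lp Lm)
        (-(Q : ℂ) * deriv (curveLam P Q L₀ Lp Lm) U * (Lp U - Lm U - 2 * ℓ)) U := by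
  have hQ0 : (Q : ℂ) ≠ 0 := Nat.cast_ne_zero.mpr hQ.ne'
  have hb : slope P Q ≠ 0 := div_ne_zero (Int.cast_ne_zero.mpr hP) hQ0
  obtain ⟨f, hf, hfd⟩ := exists_onePointSeries hb (powA ℓ (slope P Q + 1)) (powA ℓ (slope P Q - 1))
  have ht := tendsto_coordAtInfinity P Q ℓ Ω
  set u := powA ℓ (slope P Q + 1) with hu
  set v := powA ℓ (slope P Q - 1) with hv
  have hh := analyticAt_invLam (slope P Q) u v
  have hX : Tendsto (fun U => Complex.exp (-curveLam P Q L₀ Lp Lm U)) (cobounded ℂ ⊓ 𝓟 Ω) (𝓝 0) := by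
    have h1 := hh.continuousAt.tendsto.comp ht
    rw [invLam_zero] at h1
    exact h1.congr' ((h.eventually_exp_neg_curveLam hQ).mono fun U hU => hU.symm)
  have hsum : ∀ᶠ U in cobounded ℂ ⊓ 𝓟 Ω, HasSum (termF01 P Q ℓ L₀ Lp Lm U)
      ((Q : ℂ) * f (Complex.exp (-curveLam P Q L₀ Lp Lm U))) := by
    filter_upwards [hX.eventually hf] with U hU
    rw [← Equiv.pnatEquivNat.symm.hasSum_iff]
    convert! hU.2.mul_left (Q : ℂ) using 2 with n
    have hn : (((n + 1 : ℕ)) : ℂ) ≠ 0 := Nat.cast_ne_zero.mpr (Nat.succ_ne_zero n)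
    have e : (((Equiv.pnatEquivNat.symm n : ℕ+) : ℕ)) = n + 1 := Nat.succPNat_coe n
    rw [Function.comp_apply, termF01, correlator_eq_coeff_exp P Q hP hQ, e, ← hu, ← hv, Complex.exp_neg,
      inv_pow]
    field_simp
  filter_upwards [eventually_eventually_nhds_of_cobounded h.isOpen hsum, hX.eventually hf,
    ht.eventually hfd, h.eventually_exp_neg_curveLam hQ, h.eventually_sub_eq,
    mem_inf_of_right (mem_principal_self Ω)] with U hU hfU hfdU hexp hsub hUΩ
  refine ⟨hU.self_of_nhds.summable, ?_⟩
  have heq : F01 P Q ℓ L₀ Lp Lm =ᶠ[𝓝 U]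
      fun z => (Q : ℂ) * f (Complex.exp (-curveLam P Q L₀ Lp Lm z)) := by
    filter_upwards [hU] with z hz
    exact hz.tsum_eq
  have hlam := (h.differentiableAt_curveLam hUΩ).hasDerivAt
  have h1 := ((hfU.1.hasDerivAt.comp U hlam.neg.cexp).const_mul (Q : ℂ)).congr_of_eventuallyEq heq
  have hexp' : Complex.exp ((-curveLam P Q L₀ Lp Lm) U) =
      invLam (slope P Q) u v (coordAtInfinity P Q ℓ U) := hexp
  convert! h1 using 1
  rw [hsub, ← hu, ← hv, ← hfdU, hexp', hexp]
  ring

end Branch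

theorem neBot_cobounded_inf_principal {Ω : Set ℂ} (h : ¬ IsBounded Ω) :
    (cobounded ℂ ⊓ 𝓟 Ω).NeBot := by
  rw [← Filter.frequently_mem_iff_neBot]
  intro hc
  refine h ?_
  rw [Bornology.isBounded_def]
  filter_upwards [hc] with U hU using hU

end TorusKnot

end

theorem theorem9p1 (P : ℤ) (Q : ℕ) (hP : P ≠ 0) (hQ : 0 < Q) (γ δ : ℤ)
    (hγ : (Q : ℤ) * δ - P * γ = 1) (ℓ : ℂ) :
    -- the explicit formula for the one-point correlators of genus zero
    (∀ m : ℕ+, TorusKnot.correlator P Q ℓ 0 [m] =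
      (Q : ℂ) * (1 - TorusKnot.powA ℓ 2) / ((m : ℕ) : ℂ) ^ 2 * TorusKnot.xiOne P Q ℓ m) ∧
    ∀ (Ω : Set ℂ) (L₀ Lp Lm : ℂ → ℂ), TorusKnot.IsBranch P Q ℓ Ω L₀ Lp Lm →
      -- near infinity the expansion converges and satisfies the identity
      (∀ᶠ U in cobounded ℂ ⊓ 𝓟 Ω,
        Summable (TorusKnot.termF01 P Q ℓ L₀ Lp Lm U) ∧
        DifferentiableAt ℂ (TorusKnot.F01 P Q ℓ L₀ Lp Lm) U ∧
        DifferentiableAt ℂ (TorusKnot.curveLam P Q L₀ Lp Lm) U ∧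
        deriv (TorusKnot.curveLam P Q L₀ Lp Lm) U ≠ 0 ∧
        -(1 / (Q : ℂ) ^ 2) *
            TorusKnot.dLam P Q L₀ Lp Lm (TorusKnot.F01 P Q ℓ L₀ Lp Lm) U +
            1 / (Q : ℂ) * (2 * ℓ) =
          TorusKnot.curveY P Q γ L₀ Lp Lm U -
            (γ : ℂ) / (Q : ℂ) * TorusKnot.curveX P Q L₀ Lp Lm U) ∧
      -- the identity holds for every analytic continuation of the expansion
      (IsPreconnected Ω → ¬ IsBounded Ω → ∀ F : ℂ → ℂ, DifferentiableOn ℂ F Ω →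
        F =ᶠ[cobounded ℂ ⊓ 𝓟 Ω] TorusKnot.F01 P Q ℓ L₀ Lp Lm →
        ∀ U ∈ Ω, deriv (TorusKnot.curveLam P Q L₀ Lp Lm) U ≠ 0 →
          -(1 / (Q : ℂ) ^ 2) * TorusKnot.dLam P Q L₀ Lp Lm F U + 1 / (Q : ℂ) * (2 * ℓ) =
            TorusKnot.curveY P Q γ L₀ Lp Lm U -
              (γ : ℂ) / (Q : ℂ) * TorusKnot.curveX P Q L₀ Lp Lm U) := by
  refine ⟨TorusKnot.correlator_eq_xiOne P Q hP hQ ℓ, fun Ω L₀ Lp Lm h => ?_⟩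
  have hQ0 : (Q : ℂ) ≠ 0 := Nat.cast_ne_zero.mpr hQ.ne'
  refine ⟨?_, fun hΩ hunb F hF hFeq => ?_⟩
  · filter_upwards [h.eventually_F01 hP hQ, h.eventually_deriv_curveLam_ne_zero hQ,
      mem_inf_of_right (mem_principal_self Ω)] with U hU hne hUΩ
    refine ⟨hU.1, hU.2.differentiableAt, h.differentiableAt_curveLam hUΩ, hne, ?_⟩
    rw [TorusKnot.curveY_sub, TorusKnot.dLam, hU.2.deriv]
    field_simp
    ring
  · have hne := TorusKnot.neBot_cobounded_inf_principal hunb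
    have hlam : DifferentiableOn ℂ (TorusKnot.curveLam P Q L₀ Lp Lm) Ω := fun U hU =>
      (h.differentiableAt_curveLam hU).differentiableWithinAt
    -- The identity is continued in the form multiplied by `λ'`, whose two sides are holomorphic on
    -- all of `Ω`, including the zeros of `λ'`.
    have hG : DifferentiableOn ℂ (fun U => -(Q : ℂ) *
        deriv (TorusKnot.curveLam P Q L₀ Lp Lm) U * (Lp U - Lm U - 2 * ℓ)) Ω := by
      intro U hU
      obtain ⟨-, h1, h2⟩ := h.differentiableAt_log hU
      have h3 : DifferentiableAt ℂ (deriv (TorusKnot.curveLam P Q L₀ Lp Lm)) U :=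
        (hlam.deriv h.isOpen).differentiableAt (h.isOpen.mem_nhds hU)
      exact ((h3.const_mul _).mul ((h1.sub h2).sub_const _)).differentiableWithinAt
    -- Unboundedness of `Ω` makes the filter at infinity nontrivial and so supplies a base point for
    -- the identity theorem.
    obtain ⟨U₀, ⟨hU₀, hF₀⟩, hU₀Ω⟩ :=
      (((TorusKnot.eventually_eventually_nhds_of_cobounded h.isOpen (h.eventually_F01 hP hQ)).and
        (TorusKnot.eventually_eventually_nhds_of_cobounded h.isOpen hFeq)).and
          (mem_inf_of_right (mem_principal_self Ω))).exists
    have heq : deriv F =ᶠ[𝓝 U₀] fun U => -(Q : ℂ) *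
        deriv (TorusKnot.curveLam P Q L₀ Lp Lm) U * (Lp U - Lm U - 2 * ℓ) := by
      filter_upwards [hU₀, hF₀.eventually_nhds] with U hU hFU
      rw [Filter.EventuallyEq.deriv_eq hFU, hU.2.deriv]
    have hon := ((hF.deriv h.isOpen).analyticOnNhd h.isOpen).eqOn_of_preconnected_of_eventuallyEq
      (hG.analyticOnNhd h.isOpen) hΩ hU₀Ω heq
    intro U hU hne'
    rw [TorusKnot.curveY_sub, TorusKnot.dLam, hon hU]
    field_simp
    ring
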